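/- **Theorem (Compactness under superlinear growth).** *Setting.* Let $V$ be a finite set, $\mathcal X=\mathbb Z^d\times V$, and let $(\mathcal X,\mathcal E)$ be a locally finite, connected, $\mathbb Z^d$-periodic graph; write $x_{\mathsf z}\in\mathbb Z^d$ for the first component of $x\in\mathcal X$, $R_0=\max_{(x,y)\in\mathcal E}|x_{\mathsf z}-y_{\mathsf z}|_\infty$ and $\mathcal E^Q=\{(x,y)\in\mathcal E: x_{\mathsf z}=0\}$. Let $\mathbb R_a^{\mathcal E}$ be the space of antisymmetric real functions on $\mathcal E$, and let $F:\mathbb R_+^{\mathcal X}\times\mathbb R_a^{\mathcal E}\to\mathbb R\cup\{+\infty\}$ be a cost function such that (a) $F$ is convex and lower semicontinuous; (b) for some $R_1<\infty$, $F(m,J)=F(m',J')$ whenever $m=m'$ at all $x$ with $|x_{\mathsf z}|_\infty\le R_1$ and $J=J'$ at all $(x,y)\in\mathcal E$ with $|x_{\mathsf z}|_\infty,|y_{\mathsf z}|_\infty\le R_1$; (c) with $R=\max\{R_0,R_1\}$, $m_0=\sum_{|x_{\mathsf z}|_\infty\le R}m(x)$ and $J_0=\sum_{(x,y)\in\mathcal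 E^Q}|J(x,y)|$, there are $c>0$, $C<\infty$ with $F(m,J)\ge cJ_0-C(1+m_0)$ for all $(m,J)$; (d) the interior of $\{F<\infty\}$ contains some $(m^\circ,J^\circ)$ with $m^\circ,J^\circ$ $\mathbb Z^d$-periodic and $J^\circ$ divergence-free. Assume in addition that $F$ has *superlinear growth*: there are $\theta:[0,\infty)\to[0,\infty)$ with $\theta(t)/t\to\infty$ as $t\to\infty$ and $C\in\mathbb R$ such that $F(m,J)\ge (m_0+1)\,\theta\big(\tfrac{J_0}{m_0+1}\big)-C(m_0+1)$ for all $(m,J)$. For $\varepsilon>0$ with $1/\varepsilon\in\mathbb N$ and $\varepsilon R_0<\frac12$, let $\mathbb Z_\varepsilon^d=(\mathbb Z/\frac1\varepsilon\mathbb Z)^d$ and let $\mathcal X_\varepsilon=\mathbb Z_\varepsilon^d\times V$, with edge set $\mathcal E_\varepsilon$ the image of $\mathcal E$ under reduction modulo $1/\varepsilon$. For $z\in\mathbb Z^d_\varepsilon$ let $\tau_\varepsilon^z$ denote composition with $(w,v)\mapsto(z+w \bmod \frac1\varepsilon,v)$, and put $\mathcal F_\varepsilon(m,J)=\sum_{z\in\mathbb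 Z_\varepsilon^d}\varepsilon^d F\big(\varepsilon^{-d}\tau_\varepsilon^z m,\varepsilon^{1-d}\tau_\varepsilon^zJ\big)$. Let $\mathcal I=(a,b)$ be a bounded nonempty open interval. For $m:\mathcal I\to\mathbb R_+^{\mathcal X_\varepsilon}$ let $$\mathcal A_\varepsilon^{\mathcal I}(m)=\inf_J\int_{\mathcal I}\mathcal F_\varepsilon(m_t,J_t)\,dt ,$$ the infimum being over Borel $J:\mathcal I\to\mathbb R_a^{\mathcal E_\varepsilon}$ such that $m$ is continuous and $\partial_tm_t(x)+\sum_{y\sim x}J_t(x,y)=0$ on $\mathcal I$ in the sense of distributions for every $x\in\mathcal X_\varepsilon$ ($\inf\emptyset=+\infty$). Let $\iota_\varepsilon m=\varepsilon^{-d}\sum_{x\in\mathcal X_\varepsilon}m(x)\,\mathscr L^d|_{Q_\varepsilon^{x_{\mathsf z}}}\in\mathcal M_+(\mathbb T^d)$ with $Q_\varepsilon^z=\varepsilon z+[0,\varepsilon)^d\subset\mathbb T^d$, and let $\|\sigma\|_{\mathrm{KR}}=\sup\{\int\psi\,d\sigma:\psi\in C(\mathbb T^d),\ \|\psi\|_\infty\le1,\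 \mathrm{Lip}(\psi)\le1\}$ for finite signed measures $\sigma$ on $\mathbb T^d$. The space $W^{1,1}_{\mathrm{KR}}(\mathcal I;\mathcal M_+(\mathbb T^d))$ consists of the curves $(\mu_t)_{t\in\mathcal I}$ of finite positive measures that are Bochner integrable as maps into $C^1(\mathbb T^d)^*$ and have a weak derivative in $L^1$ in the weak-$*$ sense: there is a weak-$*$ measurable $g:\mathcal I\to C^1(\mathbb T^d)^*$ with $\int_{\mathcal I}\|g_t\|\,dt<\infty$ and $\int_{\mathcal I}\eta'(t)\int\varphi\,d\mu_t\,dt=-\int_{\mathcal I}\eta(t)\langle g_t,\varphi\rangle\,dt$ for all $\eta\in C_c^\infty(\mathcal I)$, $\varphi\in C^1(\mathbb T^d)$. *Claim.* Let $\varepsilon_n\to0$ be a sequence of admissible values of $\varepsilon$ and let $m^{n}:\mathcal I\to\mathbb R_+^{\mathcal X_{\varepsilon_n}}$ satisfy $$\sup_n\mathcal A^{\mathcal I}_{\varepsilon_n}(m^{n})<\infty\quad\text{and}\quad\sup_n\int_{\mathcal I}\sum_{x\in\mathcal X_{\varepsilon_n}}m^{n}_t(x)\,dt<\infty .$$ Then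 there is a curve $(\mu_t)_{t\in\mathcal I}\in W^{1,1}_{\mathrm{KR}}(\mathcal I;\mathcal M_+(\mathbb T^d))$, absolutely continuous with respect to $\|\cdot\|_{\mathrm{KR}}$ (that is, $\|\mu_t-\mu_s\|_{\mathrm{KR}}\le\int_s^th(r)\,dr$ for all $s\le t$ in $\mathcal I$ and some $h\in L^1(\mathcal I)$), such that, along a subsequence, (i) $\iota_{\varepsilon_n}m^{n}_t(dx)\,dt\to\mu_t(dx)\,dt$ weakly on $\mathcal I\times\mathbb T^d$, i.e. against all bounded continuous functions on $\mathcal I\times\mathbb T^d$; (ii) $\|\iota_{\varepsilon_n}m^{n}_t-\mu_t\|_{\mathrm{KR}}\to0$ uniformly in $t\in\mathcal I$; (iii) $t\mapsto\mu_t(\mathbb T^d)$ is constant on $\mathcal I$. -/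

import Mathlib

open MeasureTheory Filter Topology
open scoped NNReal ENNReal BoundedContinuousFunction

namespace DynOT

noncomputable section

/-! ## Discrete vector fields on a graph -/

/-- Oriented edges of a graph with adjacency relation `r`. -/
abbrev Edge {α : Type*} (r : α → α → Prop) : Type _ := {p : α × α // r p.1 p.2}

/-- The space of discrete vector fields: antisymmetric real functions on the edges. It carries
the topology of pointwise convergence. -/
def AntisymField {α : Type*} (r : α → α → Prop) : Submodule ℝ (Edge r → ℝ) where
  carrier := {J | ∀ x y (h : r x y) (h' : r y x), J ⟨(x, y), h⟩ = -J ⟨(y, x), h'⟩}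
  add_mem' {J K} hJ hK := by
    intro x y h h'
    simp only [Pi.add_apply, hJ x y h h', hK x y h h']
    ring
  zero_mem' := by intro x y h h'; simp
  smul_mem' c J hJ := by
    intro x y h h'
    simp only [Pi.smul_apply, hJ x y h h', smul_eq_mul]
    ring

/-- Discrete divergence `∑_{y ∼ x} J(x,y)` (the neighbourhoods are finite for all graphs below). -/
def divergence {α : Type*} {r : α → α → Prop} (J : AntisymField r) (x : α) : ℝ :=
  ∑ᶠ y : {y : α // r x y}, J.1 ⟨(x, y.1), y.2⟩

/-! ## Periodic graphs and admissible cost functions -/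

/-- The vertex set `ℤ^d × V`. -/
abbrev Vertex (d : ℕ) (V : Type*) : Type _ := (Fin d → ℤ) × V

/-- The shift operator `(z, v) ↦ (z̄ + z, v)`. -/
def shift {d : ℕ} {V : Type*} (z : Fin d → ℤ) (x : Vertex d V) : Vertex d V := (z + x.1, x.2)

/-- A locally finite, connected, `ℤ^d`-periodic graph on `ℤ^d × V`. -/
structure PeriodicGraph (d : ℕ) (V : Type*) where
  Adj : Vertex d V → Vertex d V → Prop
  symm : ∀ x y, Adj x y → Adj y x
  periodic : ∀ (z : Fin d → ℤ) (x y : Vertex d V), Adj (shift z x) (shift z y) ↔ Adj x y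
  locallyFinite : ∀ x, {y | Adj x y}.Finite
  connected : ∀ x y, Relation.ReflTransGen Adj x y

variable {d : ℕ} {V : Type*}

/-- The maximal edge length `R₀`; the norm on `ℤ^d` is the supremum norm. -/
def PeriodicGraph.maxEdgeLength (G : PeriodicGraph d V) : ℝ :=
  sSup {r | ∃ x y, G.Adj x y ∧ r = ‖x.1 - y.1‖}

/-- The edges `(x, y)` with `x_z = 0`. -/
abbrev PeriodicGraph.UnitEdge (G : PeriodicGraph d V) : Type _ :=
  {e : Edge G.Adj // e.1.1.1 = 0}

/-- The total flux `∑ |J(x,y)|` over the edges with `x_z = 0` (a finite sum). -/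
def PeriodicGraph.unitFlux (G : PeriodicGraph d V) (J : AntisymField G.Adj) : ℝ :=
  ∑ᶠ e : G.UnitEdge, |J.1 e.1|

/-- The mass `∑ m(x)` over the vertices with `|x_z|_∞ ≤ R` (a finite sum). -/
def localMass (R : ℝ) (m : Vertex d V → ℝ≥0) : ℝ :=
  ∑ᶠ x : {x : Vertex d V // ‖x.1‖ ≤ R}, (m x.1 : ℝ)

lemma finite_unitEdge [Finite V] (G : PeriodicGraph d V) : Finite G.UnitEdge := by
  have hs : (⋃ v : V, {y | G.Adj ((0 : Fin d → ℤ), v) y}).Finite :=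
    Set.finite_iUnion fun v => G.locallyFinite _
  have : Finite (V × ↥(⋃ v : V, {y | G.Adj ((0 : Fin d → ℤ), v) y})) := by
    have := hs.to_subtype
    infer_instance
  refine Finite.of_injective
    (β := V × ↥(⋃ v : V, {y | G.Adj ((0 : Fin d → ℤ), v) y}))
    (fun e => (e.1.1.1.2, ⟨e.1.1.2, Set.mem_iUnion.2 ⟨e.1.1.1.2, by
      have h := e.1.2
      have h0 := e.2
      have : e.1.1.1 = ((0 : Fin d → ℤ), e.1.1.1.2) := Prod.ext h0 rfl
      rw [this] at h
      exact h⟩⟩)) ?_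
  rintro ⟨⟨⟨⟨z, v⟩, y⟩, h⟩, h0⟩ ⟨⟨⟨⟨z', v'⟩, y'⟩, h'⟩, h0'⟩ he
  simp only [Prod.mk.injEq, Subtype.mk.injEq] at he h0 h0' ⊢
  exact ⟨⟨h0.trans h0'.symm, he.1⟩, he.2⟩

lemma finite_ball [Finite V] (R : ℝ) : Finite {x : Vertex d V // ‖x.1‖ ≤ R} := by
  have h : (Metric.closedBall (0 : Fin d → ℤ) R).Finite :=
    (isCompact_closedBall (0 : Fin d → ℤ) R).finite_of_discrete
  have : ({x : Vertex d V | ‖x.1‖ ≤ R}).Finite := by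
    refine (h.prod (Set.finite_univ (α := V))).subset ?_
    intro x hx
    simpa using hx
  exact this.to_subtype

/-- A cost function `F : ℝ_+^X × ℝ_a^E → ℝ ∪ {+∞}` (the value `⊥` is excluded in
`IsAdmissible`). -/
abbrev Cost (G : PeriodicGraph d V) : Type _ :=
  (Vertex d V → ℝ≥0) → AntisymField G.Adj → EReal

/-- Admissible cost functions, with locality radius `R₁`. -/
structure IsAdmissible (G : PeriodicGraph d V) (R₁ : ℝ) (F : Cost G) : Prop where
  ne_bot : ∀ m J, F m J ≠ ⊥
  convex : ∀ (s t : ℝ≥0), s + t = 1 → ∀ m m' J J',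
    F (s • m + t • m') ((s : ℝ) • J + (t : ℝ) • J')
      ≤ ((s : ℝ) : EReal) * F m J + ((t : ℝ) : EReal) * F m' J'
  lsc : LowerSemicontinuous fun p : (Vertex d V → ℝ≥0) × AntisymField G.Adj => F p.1 p.2
  local_dep : ∀ m m' J J', (∀ x : Vertex d V, ‖x.1‖ ≤ R₁ → m x = m' x) →
    (∀ e : Edge G.Adj, ‖e.1.1.1‖ ≤ R₁ → ‖e.1.2.1‖ ≤ R₁ → J.1 e = J'.1 e) → F m J = F m' J'
  linear_growth : ∃ c C : ℝ, 0 < c ∧ ∀ m J,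
    ((c * G.unitFlux J - C * (1 + localMass (max G.maxEdgeLength R₁) m) : ℝ) : EReal) ≤ F m J
  interior_domain : ∃ (m : Vertex d V → ℝ≥0) (J : AntisymField G.Adj),
    (∀ z x, m (shift z x) = m x) ∧
    (∀ z x y (h : G.Adj x y) (h' : G.Adj (shift z x) (shift z y)),
      J.1 ⟨(shift z x, shift z y), h'⟩ = J.1 ⟨(x, y), h⟩) ∧
    (∀ x, divergence J x = 0) ∧
    (m, J) ∈ interior {p : (Vertex d V → ℝ≥0) × AntisymField G.Adj | F p.1 p.2 < ⊤}

/-- Superlinear growth of the cost function. -/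
def IsSuperlinear (G : PeriodicGraph d V) (R₁ : ℝ) (F : Cost G) : Prop :=
  ∃ (θ : ℝ≥0 → ℝ≥0) (C : ℝ), Tendsto (fun t => θ t / t) atTop atTop ∧ ∀ m J,
    (((localMass (max G.maxEdgeLength R₁) m + 1) *
          θ (Real.toNNReal (G.unitFlux J / (localMass (max G.maxEdgeLength R₁) m + 1)))
        - C * (localMass (max G.maxEdgeLength R₁) m + 1) : ℝ) : EReal) ≤ F m J

/-! ## The rescaled graph, with `ε = 1 / N` -/

/-- The vertex set `X_ε = (ℤ/Nℤ)^d × V`. The class `[ε z]` is represented by `z` modulo `N`. -/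
abbrev TVertex (d : ℕ) (V : Type*) (N : ℕ) : Type _ := (Fin d → ZMod N) × V

/-- The map `T_ε^{z̄} : X → X_ε`, `(z, v) ↦ (z̄ + z mod N, v)`. -/
def wrap (N : ℕ) (z : Fin d → ZMod N) (x : Vertex d V) : TVertex d V N :=
  (fun i => z i + (x.1 i : ZMod N), x.2)

/-- The edges of the rescaled graph: images of edges of the periodic graph under `T_ε^0`. -/
def PeriodicGraph.TAdj (G : PeriodicGraph d V) (N : ℕ) (p q : TVertex d V N) : Prop :=
  ∃ x y, G.Adj x y ∧ wrap N 0 x = p ∧ wrap N 0 y = q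

lemma PeriodicGraph.tadj_wrap (G : PeriodicGraph d V) (N : ℕ) (z : Fin d → ZMod N)
    {x y : Vertex d V} (h : G.Adj x y) : G.TAdj N (wrap N z x) (wrap N z y) := by
  choose w hw using fun i => ZMod.intCast_surjective (z i)
  refine ⟨shift w x, shift w y, (G.periodic w x y).2 h, ?_, ?_⟩ <;>
  · refine Prod.ext ?_ rfl
    funext i
    simp [wrap, shift, hw]

/-- The mesh size `ε = 1 / N`. -/
def mesh (N : ℕ) : ℝ≥0 := 1 / N

/-- `τ_ε^z m / ε^d`. -/
def blowUpMass (N : ℕ) (z : Fin d → ZMod N) (m : TVertex d V N → ℝ≥0) : Vertex d V → ℝ≥0 :=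
  fun x => m (wrap N z x) / mesh N ^ d

/-- `τ_ε^z J / ε^(d-1)`. -/
def blowUpFlux (G : PeriodicGraph d V) (N : ℕ) (z : Fin d → ZMod N)
    (J : AntisymField (G.TAdj N)) : AntisymField G.Adj :=
  ⟨fun e => J.1 ⟨(wrap N z e.1.1, wrap N z e.1.2), G.tadj_wrap N z e.2⟩
      / (mesh N : ℝ) ^ ((d : ℤ) - 1), by
    intro x y h h'
    show J.1 _ / _ = -(J.1 _ / _)
    rw [J.2 _ _ (G.tadj_wrap N z h) (G.tadj_wrap N z h'), neg_div]⟩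

/-- The rescaled energy `∑_z ε^d F(τ_ε^z m / ε^d, τ_ε^z J / ε^(d-1))`. -/
def energy (G : PeriodicGraph d V) (F : Cost G) (N : ℕ) [NeZero N]
    (m : TVertex d V N → ℝ≥0) (J : AntisymField (G.TAdj N)) : EReal :=
  ∑ z : Fin d → ZMod N,
    (((mesh N : ℝ) ^ d : ℝ) : EReal) * F (blowUpMass N z m) (blowUpFlux G N z J)

/-! ## Discrete continuity equation and action on the time interval `(a, b)` -/

/-- The open time interval `(a, b)`, as a type. -/
abbrev Time (a b : ℝ) : Type := ↥(Set.Ioo a b)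

/-- Lebesgue measure on `(a, b)`. -/
def timeVol (a b : ℝ) : Measure (Time a b) := Measure.comap Subtype.val (volume : Measure ℝ)

/-- Smooth compactly supported functions of time. -/
structure IsTimeTest (a b : ℝ) (η : ℝ → ℝ) : Prop where
  smooth : ContDiff ℝ (⊤ : ℕ∞) η
  compact : HasCompactSupport η
  support : tsupport η ⊆ Set.Ioo a b

/-- The integral in `[-∞, +∞]` of an extended real function whose negative part has finite
integral. -/
def eintegral {α : Type*} [MeasurableSpace α] (ν : Measure α) (f : α → EReal) : EReal :=
  ((∫⁻ t, (f t).toENNReal ∂ν : ℝ≥0∞) : EReal) - ((∫⁻ t, (-f t).toENNReal ∂ν : ℝ≥0∞) : EReal)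

/-- The discrete continuity equation `∂_t m_t + div J_t = 0` in the sense of distributions. -/
structure DiscreteCE (G : PeriodicGraph d V) (a b : ℝ) (N : ℕ)
    (m : Time a b → TVertex d V N → ℝ≥0) (J : Time a b → AntisymField (G.TAdj N)) : Prop where
  continuous_mass : Continuous m
  measurable_flux : ∀ e, Measurable fun t => (J t).1 e
  locallyIntegrable_div : ∀ x, LocallyIntegrable (fun t => divergence (J t) x) (timeVol a b)
  equation : ∀ (x : TVertex d V N) (η : ℝ → ℝ), IsTimeTest a b η →
    ∫ t, deriv η t * (m t x : ℝ) ∂(timeVol a b) = ∫ t, η t * divergence (J t) x ∂(timeVol a b)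

/-- The discrete action of a curve: infimum over all fluxes solving the continuity equation
(equal to `⊤` if there is none). -/
def action (G : PeriodicGraph d V) (F : Cost G) (a b : ℝ) (N : ℕ) [NeZero N]
    (m : Time a b → TVertex d V N → ℝ≥0) : EReal :=
  ⨅ (J : Time a b → AntisymField (G.TAdj N)) (_ : DiscreteCE G a b N m J),
    eintegral (timeVol a b) fun t => energy G F N (m t) (J t)

/-- The space-time mass of a discrete curve. -/
def totalMass [Fintype V] {a b : ℝ} {N : ℕ} [NeZero N]
    (m : Time a b → TVertex d V N → ℝ≥0) : ℝ≥0∞ :=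
  ∫⁻ t, ∑ x, (m t x : ℝ≥0∞) ∂(timeVol a b)

/-! ## Measures on the torus -/

/-- The flat torus `ℝ^d / ℤ^d`. -/
abbrev Torus (d : ℕ) : Type := UnitAddTorus (Fin d)

/-- The half-open cube `Q_ε^z = ε z + [0, ε)^d` in the torus. -/
def cube (N : ℕ) (z : Fin d → ZMod N) : Set (Torus d) :=
  {u | ∃ s : Fin d → ℝ, (∀ i, s i ∈ Set.Ico (0 : ℝ) 1) ∧
    u = fun i => (((mesh N : ℝ) * ((z i).val + s i) : ℝ) : UnitAddCircle)}

/-- Lebesgue measure on the torus. -/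
def lebesgue (d : ℕ) : FiniteMeasure (Torus d) := ⟨volume, inferInstance⟩

/-- The embedding `ι_ε m = ε^{-d} ∑_x m(x) 𝓛^d|_{Q_ε^{x_z}}`. -/
def embed [Fintype V] (N : ℕ) [NeZero N] (m : TVertex d V N → ℝ≥0) : FiniteMeasure (Torus d) :=
  ∑ x : TVertex d V N, ((mesh N ^ d)⁻¹ * m x) • (lebesgue d).restrict (cube N x.1)

/-- The flat (Euclidean) distance on the torus; `‖·‖` is the distance to `0` in `ℝ / ℤ`. -/
def flatDist (x y : Torus d) : ℝ := Real.sqrt (∑ i, ‖x i - y i‖ ^ 2)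

/-- The Kantorovich–Rubinstein norm `‖μ - ν‖_KR` of the difference of two finite measures:
supremum of `∫ ψ d(μ - ν)` over continuous `ψ` with `‖ψ‖_∞ ≤ 1` and `Lip ψ ≤ 1`. -/
def krDist (μ ν : FiniteMeasure (Torus d)) : ℝ :=
  sSup {r | ∃ ψ : C(Torus d, ℝ), (∀ x, |ψ x| ≤ 1) ∧ (∀ x y, |ψ x - ψ y| ≤ flatDist x y) ∧
    r = ∫ x, ψ x ∂(μ : Measure (Torus d)) - ∫ x, ψ x ∂(ν : Measure (Torus d))}

/-- The space-time measure `μ(dx, dt) = μ_t(dx) dt` on `(a, b) × 𝕋^d`. -/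
def spaceTime {a b : ℝ} (μ : Time a b → FiniteMeasure (Torus d)) :
    Measure (Time a b × Torus d) :=
  (timeVol a b).bind fun t =>
    (μ t : Measure (Torus d)).map fun x => (t, x)

/-- Weak convergence of measures: convergence of integrals of bounded continuous functions. -/
def TendstoWeakly {X : Type*} [TopologicalSpace X] [MeasurableSpace X]
    (μs : ℕ → Measure X) (μ : Measure X) : Prop :=
  ∀ ψ : X →ᵇ ℝ, Tendsto (fun n => ∫ p, ψ p ∂(μs n)) atTop (𝓝 (∫ p, ψ p ∂μ))

/-! ## The space `W^{1,1}_KR` -/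

/-- The covering map `ℝ^d → 𝕋^d`. -/
def toTorus (x : EuclideanSpace ℝ (Fin d)) : Torus d := fun i => (x i : UnitAddCircle)

/-- `C¹(𝕋^d)` as a space of pairs `(φ, ∇φ)` of a continuous function and its continuous gradient
(which is determined by `φ`). -/
def c1Submodule (d : ℕ) :
    Submodule ℝ (C(Torus d, ℝ) × C(Torus d, EuclideanSpace ℝ (Fin d))) where
  carrier := {p | ∀ x, HasGradientAt (fun y => p.1 (toTorus y)) (p.2 (toTorus x)) x}
  add_mem' {p q} hp hq := by
    intro x
    have h := (hp x).hasFDerivAt.add (hq x).hasFDerivAt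
    rw [← map_add] at h
    exact hasGradientAt_iff_hasFDerivAt.2 h
  zero_mem' := by
    intro x
    exact hasGradientAt_const x (0 : ℝ)
  smul_mem' c p hp := by
    intro x
    have h := (hp x).hasFDerivAt.const_smul c
    have e : InnerProductSpace.toDual ℝ _ (c • p.2 (toTorus x)) =
        c • InnerProductSpace.toDual ℝ _ (p.2 (toTorus x)) := by simp
    rw [← e] at h
    exact hasGradientAt_iff_hasFDerivAt.2 h

/-- The normed space `C¹(𝕋^d)`, with norm `max ‖φ‖_∞ ‖∇φ‖_∞`. -/
def C1Torus (d : ℕ) : Type := ↥(c1Submodule d)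

instance (d : ℕ) : NormedAddCommGroup (C1Torus d) :=
  inferInstanceAs (NormedAddCommGroup ↥(c1Submodule d))

instance (d : ℕ) : NormedSpace ℝ (C1Torus d) :=
  inferInstanceAs (NormedSpace ℝ ↥(c1Submodule d))

/-- The function underlying an element of `C¹(𝕋^d)`. -/
def C1Torus.fn (φ : C1Torus d) : C(Torus d, ℝ) := φ.1.1

/-- The gradient of an element of `C¹(𝕋^d)`. -/
def C1Torus.grad (φ : C1Torus d) : C(Torus d, EuclideanSpace ℝ (Fin d)) := φ.1.2

lemma C1Torus.norm_eq (φ : C1Torus d) : ‖φ‖ = max ‖φ.fn‖ ‖φ.grad‖ := rfl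

/-- A finite measure, as an element of the dual of `C¹(𝕋^d)`: `φ ↦ ∫ φ dμ`. -/
def toDual (μ : FiniteMeasure (Torus d)) : StrongDual ℝ (C1Torus d) :=
  LinearMap.mkContinuous
    { toFun := fun φ : C1Torus d => ∫ x, φ.fn x ∂(μ : Measure (Torus d))
      map_add' := fun φ ψ => by
        have h (f : C(Torus d, ℝ)) : Integrable f (μ : Measure (Torus d)) :=
          (BoundedContinuousFunction.mkOfCompact f).integrable _
        exact integral_add (h φ.fn) (h ψ.fn)
      map_smul' := fun c φ => integral_const_mul c (fun x => φ.fn x) }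
    ((μ : Measure (Torus d)).real Set.univ) (fun φ => by
      have h := norm_integral_le_of_norm_le_const (μ := (μ : Measure (Torus d)))
        (f := fun x => φ.fn x) (C := ‖φ‖)
        (Eventually.of_forall fun x =>
          (φ.fn.norm_coe_le_norm x).trans (by rw [φ.norm_eq]; exact le_max_left _ _))
      rw [mul_comm]
      exact h)

/-- The curve `μ` belongs to `W^{1,1}((a,b); C¹(𝕋^d)*)`. The space `C¹(𝕋^d)*` is the dual of a
separable Banach space, and the weak derivative is taken in the corresponding weak* sense: it is
a weak* measurable map `g` with integrable norm, characterised by testing against `η(t) φ(x)`. -/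
def MemW11KR {a b : ℝ} (μ : Time a b → FiniteMeasure (Torus d)) : Prop :=
  Integrable (fun t => toDual (μ t)) (timeVol a b) ∧
  ∃ g : Time a b → StrongDual ℝ (C1Torus d),
    (∀ φ, Measurable fun t => g t φ) ∧
    Integrable (fun t => ‖g t‖) (timeVol a b) ∧
    ∀ (φ : C1Torus d) (η : ℝ → ℝ), IsTimeTest a b η →
      ∫ t, deriv η t * toDual (μ t) φ ∂(timeVol a b) = -∫ t, η t * g t φ ∂(timeVol a b)

/-- Absolute continuity with respect to the Kantorovich–Rubinstein norm. -/
def KRAbsCont {a b : ℝ} (μ : Time a b → FiniteMeasure (Torus d)) : Prop :=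
  ∃ h : ℝ → ℝ, IntegrableOn h (Set.Ioo a b) ∧
    ∀ s t : Time a b, s ≤ t → krDist (μ t) (μ s) ≤ ∫ r in (s : ℝ)..t, h r

end

end DynOT

open DynOT

namespace DynOT

/-! ### The Kantorovich-Rubinstein distance -/

section KantorovichRubinstein

variable {d : ℕ}

/-! Choose fluxes `J n` whose actions lie below one common constant. Superlinearity of `F` says that
for every slope `K` there is `C K` with `F(m,J) ≥ K J₀ - C K (1 + m₀)`. Summed over the cells of the
rescaled graph, this bounds the energy below by `K ε ∑|J|` minus an affine function of the total
mass.

With slope 1 the fluxes are integrable in time, so the continuity equation holds in integrated form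
(`sub_eq_integral_of_weak_derivative`) and the total mass is constant in time. The bound on its time
integral is then a bound uniform in `n` and `t`. Returning to arbitrary `K`, the speeds `j n = ε ∑|J
n|` satisfy `K ∫_S j n ≤ A + C'_K |S|` with `A` independent of `K`: they are equi-integrable. Linear
growth alone would leave room for concentration in time.

Up to a constant, `j n` bounds the metric speed of the embedded curve in the Kantorovich–Rubinstein
norm (`DiscreteCE.krDist_embed_le`): summation by parts moves the divergence onto the cell averages
of a 1-Lipschitz test function, and these differ by `O(ε)` across an edge.

The rest concerns curves of measures only. Equi-integrable speed gives equicontinuity, bounded mass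
on the compact torus gives pointwise compactness, and an Arzelà–Ascoli argument gives uniform
convergence (`exists_subseq_curves`). A weak limit of the speeds is absolutely continuous with some
density `h` (`exists_limit_density`), which dominates the speed of the limit curve. Such a curve has
a weak-* derivative in the dual of `C¹` (`exists_weakStar_derivative`). Convergence at every time
and dominated convergence give the space-time convergence. -/

lemma flatDist_nonneg (x y : Torus d) : 0 ≤ flatDist x y := Real.sqrt_nonneg _

lemma dist_le_flatDist (x y : Torus d) : dist x y ≤ flatDist x y := by
  refine (dist_pi_le_iff (flatDist_nonneg x y)).2 fun i => ?_
  rw [dist_eq_norm]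
  refine Real.le_sqrt_of_sq_le ?_
  exact Finset.single_le_sum (f := fun i => ‖x i - y i‖ ^ 2) (fun j _ => sq_nonneg _)
    (Finset.mem_univ i)

lemma flatDist_le_of_forall_le {x y : Torus d} {r : ℝ} (hr : 0 ≤ r)
    (h : ∀ i, ‖x i - y i‖ ≤ r) : flatDist x y ≤ Real.sqrt d * r := by
  rw [flatDist]
  calc Real.sqrt (∑ i, ‖x i - y i‖ ^ 2) ≤ Real.sqrt (∑ _i : Fin d, r ^ 2) := by
        refine Real.sqrt_le_sqrt (Finset.sum_le_sum fun i _ => ?_)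
        exact pow_le_pow_left₀ (norm_nonneg _) (h i) 2
    _ = Real.sqrt d * r := by
        rw [Finset.sum_const, Finset.card_univ, Fintype.card_fin, nsmul_eq_mul,
          Real.sqrt_mul (Nat.cast_nonneg d), Real.sqrt_sq hr]

lemma flatDist_le_dist (x y : Torus d) : flatDist x y ≤ Real.sqrt d * dist x y :=
  flatDist_le_of_forall_le dist_nonneg fun i => by
    rw [← dist_eq_norm]; exact dist_le_pi_dist x y i

/-- Test functions of the Kantorovich–Rubinstein norm. -/
def krTests (d : ℕ) : Set C(Torus d, ℝ) :=
  {ψ | (∀ x, |ψ x| ≤ 1) ∧ ∀ x y, |ψ x - ψ y| ≤ flatDist x y}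

section

variable {X : Type*} [TopologicalSpace X] [CompactSpace X] [MeasurableSpace X]

lemma abs_integral_le_norm_mul_mass (ψ : C(X, ℝ)) (μ : FiniteMeasure X) :
    |∫ x, ψ x ∂(μ : Measure X)| ≤ ‖ψ‖ * μ.mass := by
  have h := norm_integral_le_of_norm_le_const (μ := (μ : Measure X))
    (f := fun x => ψ x) (C := ‖ψ‖) (Eventually.of_forall fun x => ψ.norm_coe_le_norm x)
  exact h

variable [BorelSpace X]

lemma integrable_continuousMap (ψ : C(X, ℝ)) (μ : FiniteMeasure X) :
    Integrable ψ (μ : Measure X) :=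
  (BoundedContinuousFunction.mkOfCompact ψ).integrable _

lemma integral_sub_continuousMap (ψ φ : C(X, ℝ)) (μ : FiniteMeasure X) :
    ∫ x, (ψ - φ) x ∂(μ : Measure X) =
      ∫ x, ψ x ∂(μ : Measure X) - ∫ x, φ x ∂(μ : Measure X) :=
  integral_sub (integrable_continuousMap ψ μ) (integrable_continuousMap φ μ)

lemma continuous_integral_of_continuousMap (μ : FiniteMeasure X) :
    Continuous fun ψ : C(X, ℝ) => ∫ x, ψ x ∂(μ : Measure X) := by
  refine (LipschitzWith.of_dist_le_mul (K := μ.mass) fun ψ φ => ?_).continuous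
  rw [Real.dist_eq, ← integral_sub_continuousMap, dist_eq_norm, mul_comm]
  exact abs_integral_le_norm_mul_mass _ _

end

lemma norm_le_one_of_mem_krTests {ψ : C(Torus d, ℝ)} (h : ψ ∈ krTests d) : ‖ψ‖ ≤ 1 :=
  (ContinuousMap.norm_le _ zero_le_one).2 h.1

lemma neg_mem_krTests {ψ : C(Torus d, ℝ)} (h : ψ ∈ krTests d) : -ψ ∈ krTests d := by
  refine ⟨fun x => by simpa using h.1 x, fun x y => ?_⟩
  have : (-ψ) x - (-ψ) y = -(ψ x - ψ y) := by simp; ring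
  rw [this, abs_neg]
  exact h.2 x y

lemma zero_mem_krTests : (0 : C(Torus d, ℝ)) ∈ krTests d :=
  ⟨fun x => by simp, fun x y => by simpa using flatDist_nonneg x y⟩

lemma bddAbove_krDist (μ ν : FiniteMeasure (Torus d)) :
    BddAbove {r | ∃ ψ : C(Torus d, ℝ), (∀ x, |ψ x| ≤ 1) ∧
      (∀ x y, |ψ x - ψ y| ≤ flatDist x y) ∧
      r = ∫ x, ψ x ∂(μ : Measure (Torus d)) - ∫ x, ψ x ∂(ν : Measure (Torus d))} := by
  refine ⟨μ.mass + ν.mass, ?_⟩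
  rintro r ⟨ψ, h1, h2, rfl⟩
  have hn := norm_le_one_of_mem_krTests (ψ := ψ) ⟨h1, h2⟩
  have a := abs_integral_le_norm_mul_mass ψ μ
  have b := abs_integral_le_norm_mul_mass ψ ν
  have a' : ‖ψ‖ * μ.mass ≤ μ.mass := mul_le_of_le_one_left μ.mass.2 hn
  have b' : ‖ψ‖ * ν.mass ≤ ν.mass := mul_le_of_le_one_left ν.mass.2 hn
  linarith [abs_le.1 a, abs_le.1 b]

lemma sub_le_krDist {ψ : C(Torus d, ℝ)} (h : ψ ∈ krTests d) (μ ν : FiniteMeasure (Torus d)) :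
    ∫ x, ψ x ∂(μ : Measure (Torus d)) - ∫ x, ψ x ∂(ν : Measure (Torus d)) ≤ krDist μ ν :=
  le_csSup (bddAbove_krDist μ ν) ⟨ψ, h.1, h.2, rfl⟩

lemma krDist_le_iff {μ ν : FiniteMeasure (Torus d)} {c : ℝ} :
    krDist μ ν ≤ c ↔ ∀ ψ ∈ krTests d,
      ∫ x, ψ x ∂(μ : Measure (Torus d)) - ∫ x, ψ x ∂(ν : Measure (Torus d)) ≤ c := by
  refine ⟨fun h ψ hψ => (sub_le_krDist hψ μ ν).trans h, fun h => csSup_le ?_ ?_⟩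
  · exact ⟨_, 0, zero_mem_krTests.1, zero_mem_krTests.2, rfl⟩
  · rintro r ⟨ψ, h1, h2, rfl⟩
    exact h ψ ⟨h1, h2⟩

lemma abs_sub_le_krDist {ψ : C(Torus d, ℝ)} (h : ψ ∈ krTests d) (μ ν : FiniteMeasure (Torus d)) :
    |∫ x, ψ x ∂(μ : Measure (Torus d)) - ∫ x, ψ x ∂(ν : Measure (Torus d))| ≤ krDist μ ν := by
  rw [abs_le]
  have h2 := sub_le_krDist (neg_mem_krTests h) μ ν
  simp only [ContinuousMap.coe_neg, Pi.neg_apply, integral_neg] at h2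
  exact ⟨by linarith, sub_le_krDist h μ ν⟩

lemma krDist_nonneg (μ ν : FiniteMeasure (Torus d)) : 0 ≤ krDist μ ν := by
  simpa using sub_le_krDist zero_mem_krTests μ ν

lemma krDist_comm (μ ν : FiniteMeasure (Torus d)) : krDist μ ν = krDist ν μ := by
  apply le_antisymm <;>
  · refine krDist_le_iff.2 fun ψ hψ => ?_
    first
    | linarith [(abs_le.1 (abs_sub_le_krDist hψ μ ν)).1]
    | linarith [(abs_le.1 (abs_sub_le_krDist hψ ν μ)).1]

lemma krDist_triangle (μ ν ρ : FiniteMeasure (Torus d)) :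
    krDist μ ρ ≤ krDist μ ν + krDist ν ρ :=
  krDist_le_iff.2 fun ψ hψ => by linarith [sub_le_krDist hψ μ ν, sub_le_krDist hψ ν ρ]

/-- Arzelà–Ascoli: the test functions are bounded by 1 and equi-Lipschitz. Compactness turns
convergence against each test function into convergence uniform over all of them. -/
lemma isCompact_krTests : IsCompact (krTests d) := by
  refine ArzelaAscoli.isCompact_of_equicontinuous _ ?_ ?_
  · have himage : ContinuousMap.toFun '' krTests d =
        {f : Torus d → ℝ | (∀ x, |f x| ≤ 1) ∧ ∀ x y, |f x - f y| ≤ flatDist x y} := by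
      ext f
      constructor
      · rintro ⟨ψ, hψ, rfl⟩
        exact hψ
      · intro hf
        have hlip : LipschitzWith (Real.sqrt d).toNNReal f := by
          refine LipschitzWith.of_dist_le_mul fun x y => ?_
          rw [Real.coe_toNNReal _ (Real.sqrt_nonneg _), Real.dist_eq]
          exact (hf.2 x y).trans (flatDist_le_dist x y)
        exact ⟨⟨f, hlip.continuous⟩, hf, rfl⟩
    rw [himage]
    refine (isCompact_univ_pi fun _ : Torus d => isCompact_Icc (a := (-1 : ℝ)) (b := 1))
      |>.of_isClosed_subset ?_ fun f hf x _ => abs_le.1 (hf.1 x)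
    simp only [Set.ofPred_and, Set.ofPred_forall]
    refine IsClosed.inter (isClosed_iInter fun x => ?_)
      (isClosed_iInter fun x => isClosed_iInter fun y => ?_)
    · exact isClosed_le (by fun_prop) continuous_const
    · exact isClosed_le (by fun_prop) continuous_const
  · refine UniformEquicontinuous.equicontinuous
      (LipschitzWith.uniformEquicontinuous _ (Real.sqrt d).toNNReal fun ψ => ?_)
    refine LipschitzWith.of_dist_le_mul fun x y => ?_
    rw [Real.coe_toNNReal _ (Real.sqrt_nonneg _), Real.dist_eq]
    exact (ψ.2.2 x y).trans (flatDist_le_dist x y)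

lemma tendsto_integral_continuousMap {ι : Type*} {l : Filter ι} {μs : ι → FiniteMeasure (Torus d)}
    {μ : FiniteMeasure (Torus d)} (h : Tendsto μs l (𝓝 μ)) (ψ : C(Torus d, ℝ)) :
    Tendsto (fun i => ∫ x, ψ x ∂(μs i : Measure (Torus d))) l
      (𝓝 (∫ x, ψ x ∂(μ : Measure (Torus d)))) :=
  FiniteMeasure.tendsto_iff_forall_integral_tendsto.1 h (BoundedContinuousFunction.mkOfCompact ψ)

/-- Weak convergence of finite measures implies convergence in the Kantorovich–Rubinstein norm. -/
lemma tendsto_krDist_of_tendsto {ι : Type*} {l : Filter ι} {μs : ι → FiniteMeasure (Torus d)}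
    {μ : FiniteMeasure (Torus d)} (h : Tendsto μs l (𝓝 μ)) :
    Tendsto (fun i => krDist (μs i) μ) l (𝓝 0) := by
  rw [Metric.tendsto_nhds]
  intro δ hδ
  have hM : ∀ᶠ i in l, ((μs i).mass : ℝ) < μ.mass + 1 :=
    (NNReal.tendsto_coe.2 h.mass).eventually_lt_const (lt_add_one _)
  set M : ℝ := (μ.mass : ℝ)
  have hM0 : 0 ≤ M := μ.mass.2
  set ε : ℝ := δ / (4 * (2 * M + 1)) with hε
  have hε0 : 0 < ε := by positivity
  obtain ⟨T, hT, hcover⟩ := Metric.totallyBounded_iff.1 isCompact_krTests.totallyBounded ε hε0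
  have hev : ∀ᶠ i in l, ∀ y ∈ T, ∫ x, y x ∂(μs i : Measure (Torus d)) <
      ∫ x, y x ∂(μ : Measure (Torus d)) + δ / 4 :=
    (Set.Finite.eventually_all hT).2 fun y _ =>
      (tendsto_integral_continuousMap h y).eventually_lt_const (by linarith)
  filter_upwards [hM, hev] with i hi hi'
  rw [Real.dist_eq, sub_zero, abs_of_nonneg (krDist_nonneg _ _)]
  refine lt_of_le_of_lt (b := δ / 4 + δ / 4) (krDist_le_iff.2 fun ψ hψ => ?_) (by linarith)
  obtain ⟨y, hy, hψy⟩ := Set.mem_iUnion₂.1 (hcover hψ)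
  have hnorm : ‖ψ - y‖ ≤ ε := by rw [← dist_eq_norm]; exact (Metric.mem_ball.1 hψy).le
  have a1 := (abs_le.1 (abs_integral_le_norm_mul_mass (ψ - y) (μs i))).2
  have a2 := (abs_le.1 (abs_integral_le_norm_mul_mass (ψ - y) μ)).1
  rw [integral_sub_continuousMap] at a1 a2
  have b1 : ‖ψ - y‖ * (μs i).mass ≤ ε * (M + 1) :=
    mul_le_mul hnorm hi.le (μs i).mass.2 hε0.le
  have b2 : ‖ψ - y‖ * μ.mass ≤ ε * M := mul_le_mul_of_nonneg_right hnorm hM0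
  have b3 : ε * (2 * M + 1) = δ / 4 := by rw [hε]; field_simp
  linarith [hi' y hy]

/-- The thickened indicator of a closed set at scale `r ≤ 1` is `1/r`-Lipschitz, so `r` times it is
a test function. As `r → 0` the two measures agree on closed sets, a π-system generating the Borel
sets. -/
lemma eq_of_krDist_eq_zero {μ ν : FiniteMeasure (Torus d)} (h : krDist μ ν = 0) : μ = ν := by
  have key : ∀ (F : Set (Torus d)), IsClosed F →
      (μ : Measure (Torus d)) F = (ν : Measure (Torus d)) F := by
    intro F hF
    have hpos : ∀ n : ℕ, (0 : ℝ) < 1 / ((n : ℝ) + 1) := fun n => by positivity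
    have hlim : Tendsto (fun n : ℕ => 1 / ((n : ℝ) + 1)) atTop (𝓝 0) :=
      tendsto_one_div_add_atTop_nhds_zero_nat
    have tμ := tendsto_lintegral_thickenedIndicator_of_isClosed (μ : Measure (Torus d)) hF hpos hlim
    have tν := tendsto_lintegral_thickenedIndicator_of_isClosed (ν : Measure (Torus d)) hF hpos hlim
    refine tendsto_nhds_unique tμ (tν.congr fun n => ?_)
    set f := thickenedIndicator (hpos n) F
    set r : ℝ := 1 / ((n : ℝ) + 1)
    let ψ : C(Torus d, ℝ) := ⟨fun x => r * f x, by fun_prop⟩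
    have hr1 : r ≤ 1 := by
      refine div_le_one_of_le₀ ?_ (by positivity)
      linarith [Nat.cast_nonneg (α := ℝ) n]
    have hψ : ψ ∈ krTests d := by
      refine ⟨fun x => ?_, fun x y => ?_⟩
      · have h1 : (f x : ℝ) ≤ 1 := thickenedIndicator_le_one (hpos n) F x
        have h0 : (0 : ℝ) ≤ f x := (f x).2
        show |r * f x| ≤ 1
        rw [abs_of_nonneg (mul_nonneg (hpos n).le h0)]
        exact mul_le_one₀ hr1 h0 h1
      · have h1 := (lipschitzWith_thickenedIndicator (hpos n) F).dist_le_mul x y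
        show |r * f x - r * f y| ≤ _
        rw [← mul_sub, abs_mul, abs_of_pos (hpos n)]
        rw [NNReal.dist_eq, NNReal.coe_inv, Real.coe_toNNReal _ (hpos n).le] at h1
        calc r * |(f x : ℝ) - f y| ≤ r * (r⁻¹ * dist x y) :=
              mul_le_mul_of_nonneg_left h1 (hpos n).le
          _ = dist x y := by rw [← mul_assoc, mul_inv_cancel₀ (hpos n).ne', one_mul]
          _ ≤ _ := dist_le_flatDist x y
    have heq : ∫ x, ψ x ∂(μ : Measure (Torus d)) = ∫ x, ψ x ∂(ν : Measure (Torus d)) := by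
      have := abs_sub_le_krDist hψ μ ν
      rw [h] at this
      exact sub_eq_zero.1 (abs_nonpos_iff.1 this)
    have heq' : ∫ x, (f x : ℝ) ∂(μ : Measure (Torus d)) = ∫ x, (f x : ℝ) ∂(ν : Measure (Torus d)) := by
      have : r * ∫ x, (f x : ℝ) ∂(μ : Measure (Torus d)) =
          r * ∫ x, (f x : ℝ) ∂(ν : Measure (Torus d)) := by
        rw [← integral_const_mul, ← integral_const_mul]; exact heq
      exact mul_left_cancel₀ (hpos n).ne' this
    have hl : ∀ ρ : FiniteMeasure (Torus d), ∫⁻ x, (f x : ℝ≥0∞) ∂(ρ : Measure (Torus d)) =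
        ENNReal.ofReal (∫ x, (f x : ℝ) ∂(ρ : Measure (Torus d))) := fun ρ => by
      rw [ofReal_integral_eq_lintegral_ofReal]
      · simp
      · exact BoundedContinuousFunction.integrable_of_nnreal _ f
      · exact Eventually.of_forall fun x => (f x).2
    rw [hl, hl, heq']
  refine FiniteMeasure.toMeasure_injective ?_
  refine ext_of_generate_finite _ (BorelSpace.measurable_eq.trans borel_eq_generateFrom_isClosed)
    isPiSystem_isClosed (fun s hs => key s hs) (key _ isClosed_univ)

/-- Finite measures with uniformly bounded mass on a compact metrizable space: a countable family
of sequences has a common weakly convergent subsequence. -/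
lemma exists_subseq_tendsto_of_mass_le {X ι : Type*} [TopologicalSpace X] [CompactSpace X]
    [TopologicalSpace.MetrizableSpace X] [MeasurableSpace X] [BorelSpace X] [Countable ι] (C : ℝ≥0)
    (μs : ℕ → ι → FiniteMeasure X) (h : ∀ n i, (μs n i).mass ≤ C) :
    ∃ (μ : ι → FiniteMeasure X) (k : ℕ → ℕ), StrictMono k ∧
      ∀ i, Tendsto (fun j => μs (k j) i) atTop (𝓝 (μ i)) := by
  let := TopologicalSpace.metrizableSpaceMetric X
  let K := {μ : FiniteMeasure X | μ.mass ≤ C}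
  have : CompactSpace K :=
    isCompact_iff_compactSpace.1 (isCompact_setOfPred_finiteMeasure_le_of_compactSpace X C)
  -- Integration against a dense sequence of functions embeds the weakly compact set `K` in `ℝ^ℕ`.
  -- Hence `K` is metrizable, and the countable power `ι → K` is sequentially compact; this replaces
  -- a diagonal argument.
  let D := TopologicalSpace.denseSeq C(X, ℝ)
  let Φ : K → ℕ → ℝ := fun μ i => ∫ x, D i x ∂(μ.1 : Measure X)
  have hcont : ∀ ψ : C(X, ℝ), Continuous fun μ : K => ∫ x, ψ x ∂(μ.1 : Measure X) := fun ψ =>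
    (FiniteMeasure.continuous_integral_continuousMap ψ).comp continuous_subtype_val
  have hΦ : Continuous Φ := continuous_pi fun i => hcont (D i)
  have hinj : Function.Injective Φ := by
    intro μ ν hμν
    refine Subtype.ext (FiniteMeasure.ext_of_forall_integral_eq fun f => ?_)
    have := (TopologicalSpace.denseRange_denseSeq C(X, ℝ)).equalizer
      (continuous_integral_of_continuousMap μ.1) (continuous_integral_of_continuousMap ν.1)
      (funext fun i => congrFun hμν i)
    exact congrFun this f.toContinuousMap
  have : TopologicalSpace.MetrizableSpace K :=
    (hΦ.isClosedEmbedding hinj).isEmbedding.metrizableSpace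
  obtain ⟨μ, -, k, hk, hlim⟩ := (isCompact_univ (X := ι → K)).tendsto_subseq
    (x := fun n i => ⟨μs n i, h n i⟩) fun _ => Set.mem_univ _
  refine ⟨fun i => (μ i).1, k, hk, fun i => ?_⟩
  exact (continuous_subtype_val.tendsto _).comp ((tendsto_pi_nhds.1 hlim) i)

end KantorovichRubinstein

/-! ### The time interval -/

section Time

variable {a b : ℝ}

lemma map_val_timeVol : (timeVol a b).map Subtype.val = volume.restrict (Set.Ioo a b) :=
  map_comap_subtype_coe measurableSet_Ioo _

lemma timeVol_preimage_val {S : Set ℝ} (hS : MeasurableSet S) :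
    timeVol a b (Subtype.val ⁻¹' S) = volume (S ∩ Set.Ioo a b) := by
  rw [← Measure.map_apply measurable_subtype_coe hS, map_val_timeVol, Measure.restrict_apply hS]

instance : IsFiniteMeasure (timeVol a b) := by
  refine ⟨?_⟩
  have := timeVol_preimage_val (a := a) (b := b) (MeasurableSet.univ (α := ℝ))
  rw [Set.preimage_univ, Set.univ_inter, Real.volume_Ioo] at this
  rw [this]
  exact ENNReal.ofReal_lt_top

lemma timeVol_univ : timeVol a b Set.univ = ENNReal.ofReal (b - a) := by
  have := timeVol_preimage_val (a := a) (b := b) (MeasurableSet.univ (α := ℝ))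
  rwa [Set.preimage_univ, Set.univ_inter, Real.volume_Ioo] at this

lemma Icc_eq_preimage_val (s t : Time a b) :
    Set.Icc s t = Subtype.val ⁻¹' Set.Icc (s : ℝ) (t : ℝ) := by
  rfl

lemma timeVol_Icc (s t : Time a b) : timeVol a b (Set.Icc s t) = ENNReal.ofReal (t - s) := by
  rw [Icc_eq_preimage_val, timeVol_preimage_val measurableSet_Icc, Set.inter_eq_left.2,
    Real.volume_Icc]
  exact fun r hr => ⟨s.2.1.trans_le hr.1, hr.2.trans_lt t.2.2⟩

lemma integral_timeVol (f : ℝ → ℝ) :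
    ∫ t, f t ∂(timeVol a b) = ∫ t in Set.Ioo a b, f t := by
  rw [← map_val_timeVol, (MeasurableEmbedding.subtype_coe measurableSet_Ioo).integral_map]

lemma integrable_timeVol_iff (f : ℝ → ℝ) :
    Integrable (fun t : Time a b => f t) (timeVol a b) ↔ IntegrableOn f (Set.Ioo a b) := by
  rw [IntegrableOn, ← map_val_timeVol,
    (MeasurableEmbedding.subtype_coe measurableSet_Ioo).integrable_map_iff]
  rfl

end Time

/-! ### Weak compactness of equi-integrable densities -/

/-- Portmanteau for open sets: the mass of `U` is the supremum of the integrals of continuous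
functions between 0 and 1 that vanish off `U`, and each such integral passes to the limit. -/
lemma measure_isOpen_le_of_tendsto {X : Type*} [TopologicalSpace X] [CompactSpace X]
    [TopologicalSpace.MetrizableSpace X] [MeasurableSpace X] [BorelSpace X]
    {μs : ℕ → FiniteMeasure X} {μ : FiniteMeasure X} (h : Tendsto μs atTop (𝓝 μ)) {U : Set X}
    (hU : IsOpen U) {c : ℝ≥0∞} (hc : ∀ n, (μs n : Measure X) U ≤ c) : (μ : Measure X) U ≤ c := by
  let := TopologicalSpace.metrizableSpaceMetric X
  rw [hU.measure_eq_biSup_integral_continuous]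
  simp only [iSup_le_iff]
  intro f hf hfU hf0 hf1
  have ht : Tendsto (fun n => ENNReal.ofReal (∫ x, f x ∂(μs n : Measure X))) atTop
      (𝓝 (ENNReal.ofReal (∫ x, f x ∂(μ : Measure X)))) :=
    ENNReal.tendsto_ofReal (FiniteMeasure.tendsto_iff_forall_integral_tendsto.1 h
      (BoundedContinuousFunction.mkOfCompact ⟨f, hf⟩))
  refine le_of_tendsto' ht fun n => ?_
  refine le_trans ?_ (hc n)
  have hint : Integrable f (μs n : Measure X) := integrable_continuousMap ⟨f, hf⟩ (μs n)
  rw [ofReal_integral_eq_lintegral_ofReal hint (Eventually.of_forall hf0)]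
  refine (lintegral_mono (g := U.indicator 1) fun x => ?_).trans_eq
    (lintegral_indicator_one hU.measurableSet)
  by_cases hx : x ∈ U
  · rw [Set.indicator_of_mem hx]
    exact ENNReal.ofReal_le_one.2 (hf1 x)
  · simp [Set.indicator_of_notMem hx, hfU hx]

section Density

variable {a b : ℝ}

/-- Dunford–Pettis for densities on an interval, in the form of upper bounds for integrals over
compact subintervals. -/
lemma exists_limit_density (j : ℕ → Time a b → ℝ≥0∞) (A : ℝ≥0)
    (hui : ∀ K : ℝ≥0, ∃ C : ℝ≥0, ∀ n (S : Set (Time a b)), MeasurableSet S →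
      K * ∫⁻ r in S, j n r ∂(timeVol a b) ≤ A + C * timeVol a b S) :
    ∃ (h : ℝ → ℝ) (k : ℕ → ℕ), Integrable h ∧ StrictMono k ∧ ∀ s t : Time a b, s ≤ t → ∀ c : ℝ,
      (∃ᶠ i in atTop, ENNReal.ofReal c ≤ ∫⁻ r in Set.Icc s t, j (k i) r ∂(timeVol a b)) →
      c ≤ ∫ r in (s : ℝ)..t, h r := by
  -- The measures are moved to the compact interval `[a, b]`, where bounded mass suffices for weak
  -- compactness; mass reaching the endpoints in the limit is harmless.
  let incl : Time a b → Set.Icc a b := fun t => ⟨t, t.2.1.le, t.2.2.le⟩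
  have hincl : Measurable incl := measurable_subtype_coe.subtype_mk
  obtain ⟨C₁, hC₁⟩ := hui 1
  let C₀ : ℝ≥0 := A + C₁ * (timeVol a b Set.univ).toNNReal
  have hC₀ : ∀ n, (timeVol a b).withDensity (j n) Set.univ ≤ C₀ := by
    intro n
    have := hC₁ n Set.univ MeasurableSet.univ
    rw [withDensity_apply _ MeasurableSet.univ]
    simpa [C₀, ENNReal.coe_toNNReal (measure_ne_top (timeVol a b) Set.univ)] using this
  have hfin : ∀ n, IsFiniteMeasure (((timeVol a b).withDensity (j n)).map incl) := fun n => by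
    refine ⟨?_⟩
    rw [Measure.map_apply hincl MeasurableSet.univ, Set.preimage_univ]
    exact (hC₀ n).trans_lt ENNReal.coe_lt_top
  let νs : ℕ → FiniteMeasure (Set.Icc a b) := fun n =>
    ⟨((timeVol a b).withDensity (j n)).map incl, hfin n⟩
  have hνs : ∀ n S, MeasurableSet S →
      (νs n : Measure (Set.Icc a b)) S = ∫⁻ r in incl ⁻¹' S, j n r ∂(timeVol a b) := by
    intro n S hS
    show ((timeVol a b).withDensity (j n)).map incl S = _
    rw [Measure.map_apply hincl hS, withDensity_apply _ (hincl hS)]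
  have hmass : ∀ n (_ : Unit), (νs n).mass ≤ C₀ := by
    intro n _
    rw [← ENNReal.coe_le_coe, FiniteMeasure.ennreal_mass, hνs n _ MeasurableSet.univ,
      Set.preimage_univ, ← withDensity_apply _ MeasurableSet.univ]
    exact hC₀ n
  obtain ⟨ν', k, hk, hlim'⟩ := exists_subseq_tendsto_of_mass_le C₀ (fun n (_ : Unit) => νs n) hmass
  have hlim := hlim' ()
  set ν := ν' ()
  let νR : Measure ℝ := (ν : Measure (Set.Icc a b)).map Subtype.val
  -- A null set has an open neighbourhood `U` of volume at most `1 / (C + 1)`, on which `hui` bounds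
  -- `K` times each measure by `A + 1`. The bound passes to the limit on open sets, and `K` is
  -- arbitrary.
  have hac : νR ≪ volume := by
    intro S hS
    have key : ∀ K : ℝ≥0, (K : ℝ≥0∞) * νR S ≤ A + 1 := by
      intro K
      obtain ⟨C, hC⟩ := hui K
      rcases eq_or_ne K 0 with rfl | hK
      · simp
      have hC0 : ((C + 1 : ℝ≥0) : ℝ≥0∞)⁻¹ ≠ 0 := ENNReal.inv_ne_zero.2 ENNReal.coe_ne_top
      obtain ⟨U, hSU, hUo, hU⟩ := S.exists_isOpen_le_add volume hC0
      rw [hS, zero_add] at hU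
      have hle : (ν : Measure (Set.Icc a b)) (Subtype.val ⁻¹' U) ≤ (A + 1) / K := by
        refine measure_isOpen_le_of_tendsto hlim (hUo.preimage continuous_subtype_val) fun n => ?_
        rw [hνs _ _ (measurable_subtype_coe hUo.measurableSet)]
        rw [ENNReal.le_div_iff_mul_le (Or.inl (by simpa using hK)) (Or.inl ENNReal.coe_ne_top),
          mul_comm]
        refine (hC _ _ (hincl (measurable_subtype_coe hUo.measurableSet))).trans ?_
        gcongr
        have h1 : timeVol a b (incl ⁻¹' (Subtype.val ⁻¹' U)) ≤ ((C + 1 : ℝ≥0) : ℝ≥0∞)⁻¹ := by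
          refine le_trans ?_ hU
          refine (timeVol_preimage_val (a := a) (b := b) hUo.measurableSet).trans_le ?_
          exact measure_mono Set.inter_subset_left
        calc (C : ℝ≥0∞) * timeVol a b (incl ⁻¹' (Subtype.val ⁻¹' U))
            ≤ ((C + 1 : ℝ≥0) : ℝ≥0∞) * ((C + 1 : ℝ≥0) : ℝ≥0∞)⁻¹ := by
              gcongr
              exact le_self_add
          _ ≤ 1 := ENNReal.mul_inv_le_one _
      calc (K : ℝ≥0∞) * νR S ≤ K * νR U := by gcongr
        _ = K * (ν : Measure (Set.Icc a b)) (Subtype.val ⁻¹' U) := by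
          rw [Measure.map_apply measurable_subtype_coe hUo.measurableSet]
        _ ≤ K * ((A + 1) / K) := by gcongr
        _ ≤ A + 1 := ENNReal.mul_div_le
    by_contra hne
    have hAtop : (A : ℝ≥0∞) + 1 ≠ ⊤ := by finiteness
    obtain ⟨n, hn⟩ := ENNReal.exists_nat_mul_gt hne hAtop
    exact absurd (key n) (not_le.2 (by simpa using hn))
  refine ⟨fun x => (νR.rnDeriv volume x).toReal, k, Measure.integrable_toReal_rnDeriv, hk, ?_⟩
  intro s t hst c hc
  have hst' : (s : ℝ) ≤ t := hst
  rw [intervalIntegral.integral_of_le hst', Measure.setIntegral_toReal_rnDeriv hac]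
  -- The interval integral lives on `Ioc`, whereas the limsup inequality needs the closed interval;
  -- absolute continuity removes the difference.
  have hIcc : νR (Set.Ioc s t) = νR (Set.Icc s t) :=
    measure_congr (hac.ae_le Ioc_ae_eq_Icc)
  have hle : ENNReal.ofReal c ≤ νR (Set.Icc s t) := by
    have hcl : IsClosed (Subtype.val ⁻¹' Set.Icc (s : ℝ) t : Set (Set.Icc a b)) :=
      isClosed_Icc.preimage continuous_subtype_val
    rw [Measure.map_apply measurable_subtype_coe measurableSet_Icc]
    refine le_trans ?_ (FiniteMeasure.limsup_measure_closed_le_of_tendsto hlim hcl)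
    refine le_limsup_of_frequently_le' (hc.mono fun i hi => ?_)
    rw [hνs _ _ hcl.measurableSet]
    rwa [Icc_eq_preimage_val] at hi
  rw [measureReal_def, hIcc]
  exact (ENNReal.ofReal_le_iff_le_toReal (measure_ne_top _ _)).1 hle

end Density

/-! ### Compactness of curves of measures -/

/-- Bounded mass gives every subsequence a weakly convergent further subsequence, and its limit is
at distance 0 from `μ`. This is the converse of `tendsto_krDist_of_tendsto`. -/
lemma tendsto_of_tendsto_krDist {d : ℕ} {ρ : ℕ → FiniteMeasure (Torus d)}
    {μ : FiniteMeasure (Torus d)} {B : ℝ≥0} (hB : ∀ n, (ρ n).mass ≤ B)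
    (h : Tendsto (fun n => krDist (ρ n) μ) atTop (𝓝 0)) : Tendsto ρ atTop (𝓝 μ) := by
  refine tendsto_of_subseq_tendsto fun ns hns => ?_
  obtain ⟨ν, k, hk, hlim⟩ := exists_subseq_tendsto_of_mass_le B
    (fun n (_ : Unit) => ρ (ns n)) fun n _ => hB _
  refine ⟨k, ?_⟩
  have h1 := tendsto_krDist_of_tendsto (hlim ())
  have h2 := h.comp (hns.comp hk.tendsto_atTop)
  have h3 : krDist μ (ν ()) ≤ 0 := by
    refine ge_of_tendsto' (by simpa using h2.add h1) fun i => ?_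
    refine (krDist_triangle μ (ρ (ns (k i))) (ν ())).trans_eq ?_
    rw [krDist_comm μ]
  rw [eq_of_krDist_eq_zero (h3.antisymm (krDist_nonneg _ _))]
  exact hlim ()

section Curves

variable {d : ℕ} {a b : ℝ}

lemma equicontinuous_of_equiintegrable {ι : Type*} (ρ : ι → Time a b → FiniteMeasure (Torus d))
    (j : ι → Time a b → ℝ≥0∞) (A : ℝ≥0)
    (hui : ∀ K : ℝ≥0, ∃ C : ℝ≥0, ∀ n (S : Set (Time a b)), MeasurableSet S →
      K * ∫⁻ r in S, j n r ∂(timeVol a b) ≤ A + C * timeVol a b S)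
    (hkr : ∀ n s t, s ≤ t →
      ENNReal.ofReal (krDist (ρ n t) (ρ n s)) ≤ ∫⁻ r in Set.Icc s t, j n r ∂(timeVol a b))
    {δ : ℝ} (hδ : 0 < δ) :
    ∃ η > 0, ∀ n s t, dist s t ≤ η → krDist (ρ n s) (ρ n t) ≤ δ := by
  lift δ to ℝ≥0 using hδ.le
  -- With this slope, `C (t - s) ≤ 1` forces `(A + 1) / δ` times the distance to be at most `A + 1`.
  obtain ⟨C, hC⟩ := hui ((A + 1) / δ)
  refine ⟨1 / ((C : ℝ) + 1), by positivity, fun n => ?_⟩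
  have main : ∀ s t : Time a b, s ≤ t → dist s t ≤ 1 / ((C : ℝ) + 1) →
      krDist (ρ n t) (ρ n s) ≤ δ := by
    intro s t hst hd
    have hst' : (s : ℝ) ≤ t := hst
    have h1 := hC n (Set.Icc s t) measurableSet_Icc
    rw [timeVol_Icc] at h1
    have h2 : (C : ℝ≥0∞) * ENNReal.ofReal (t - s) ≤ 1 := by
      rw [← ENNReal.ofReal_coe_nnreal, ← ENNReal.ofReal_mul (NNReal.coe_nonneg C), ENNReal.ofReal_le_one]
      rw [Subtype.dist_eq, Real.dist_eq, abs_sub_comm, abs_of_nonneg (sub_nonneg.2 hst')] at hd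
      have hC0 : (0 : ℝ) ≤ C := C.2
      calc (C : ℝ) * (t - s) ≤ C * (1 / (C + 1)) := by gcongr
        _ ≤ 1 := by rw [mul_one_div]; exact div_le_one_of_le₀ (by linarith) (by positivity)
    have h3 : (((A + 1) / δ : ℝ≥0) : ℝ≥0∞) * ENNReal.ofReal (krDist (ρ n t) (ρ n s)) ≤
        ((A + 1 : ℝ≥0) : ℝ≥0∞) := by
      calc _ ≤ _ := mul_le_mul_right (hkr n s t hst) _
        _ ≤ _ := h1
        _ ≤ _ := by push_cast; gcongr
    rw [← ENNReal.ofReal_coe_nnreal, ← ENNReal.ofReal_mul (NNReal.coe_nonneg _),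
      ← ENNReal.ofReal_coe_nnreal, ENNReal.ofReal_le_ofReal_iff (NNReal.coe_nonneg _)] at h3
    push_cast at h3
    have hA : (0 : ℝ) < A + 1 := by positivity
    rw [div_mul_eq_mul_div, div_le_iff₀ hδ] at h3
    exact le_of_mul_le_mul_left h3 hA
  intro s t hd
  rcases le_total s t with h | h
  · rw [krDist_comm]; exact main s t h hd
  · exact main t s h (by rwa [dist_comm])

lemma totallyBounded_time : TotallyBounded (Set.univ : Set (Time a b)) := by
  have := totallyBounded_preimage (isUniformEmbedding_subtype_val (p := (· ∈ Set.Ioo a b))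
    |>.isUniformInducing) (totallyBounded_Ioo a b)
  convert this
  ext x
  simp

/-- Compactness of curves of measures with equi-integrable metric speed. -/
lemma exists_subseq_curves (ρ : ℕ → Time a b → FiniteMeasure (Torus d)) (B : ℝ≥0)
    (hB : ∀ n t, (ρ n t).mass ≤ B)
    (hequi : ∀ δ : ℝ, 0 < δ → ∃ η > 0, ∀ n s t, dist s t ≤ η → krDist (ρ n s) (ρ n t) ≤ δ) :
    ∃ (μ : Time a b → FiniteMeasure (Torus d)) (k : ℕ → ℕ), StrictMono k ∧
      ∀ δ : ℝ, 0 < δ → ∃ i₀, ∀ i, i₀ ≤ i → ∀ t, krDist (ρ (k i) t) (μ t) < δ := by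
  -- Finite nets of mesh `1 / (p + 1)`. Their union is countable, so one subsequence converges
  -- weakly at all net times.
  choose T hTfin hT using fun p : ℕ => Metric.totallyBounded_iff.1 (totallyBounded_time (a := a)
    (b := b)) (1 / ((p : ℝ) + 1)) (by positivity)
  have hcount : (⋃ p, T p).Countable := Set.countable_iUnion fun p => (hTfin p).countable
  have : Countable ↥(⋃ p, T p) := hcount.to_subtype
  obtain ⟨ν, k, hk, hlim⟩ := exists_subseq_tendsto_of_mass_le B
    (fun n (τ : ↥(⋃ p, T p)) => ρ n τ) fun n τ => hB n τ
  have hcauchy : ∀ δ : ℝ, 0 < δ → ∃ i₀, ∀ i l, i₀ ≤ i → i₀ ≤ l → ∀ t,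
      krDist (ρ (k i) t) (ρ (k l) t) ≤ δ := by
    intro δ hδ
    obtain ⟨η, hη, hmod⟩ := hequi (δ / 4) (by positivity)
    obtain ⟨p, hp⟩ := exists_nat_one_div_lt hη
    have hev : ∀ᶠ i in atTop, ∀ τ ∈ T p, ∀ hτ : τ ∈ ⋃ p, T p,
        krDist (ρ (k i) τ) (ν ⟨τ, hτ⟩) < δ / 4 := by
      refine (Set.Finite.eventually_all (hTfin p)).2 fun τ hτp => ?_
      have hτ : τ ∈ ⋃ p, T p := Set.mem_iUnion.2 ⟨p, hτp⟩
      filter_upwards [(tendsto_krDist_of_tendsto (hlim ⟨τ, hτ⟩)).eventually_lt_const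
        (show (0 : ℝ) < δ / 4 by positivity)] with i hi _
      exact hi
    obtain ⟨i₀, hi₀⟩ := eventually_atTop.1 hev
    refine ⟨i₀, fun i l hi hl t => ?_⟩
    obtain ⟨τ, hτp, hτ⟩ := Set.mem_iUnion₂.1 (hT p (Set.mem_univ t))
    have hτ' : τ ∈ ⋃ p, T p := Set.mem_iUnion.2 ⟨p, hτp⟩
    have hd : dist t τ ≤ η := (Metric.mem_ball.1 hτ).le.trans hp.le
    have h1 := hmod (k i) t τ hd
    have h2 := hmod (k l) τ t (by rwa [dist_comm])
    have h3 := hi₀ i hi τ hτp hτ'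
    have h4 := hi₀ l hl τ hτp hτ'
    rw [krDist_comm] at h4
    have t1 := krDist_triangle (ρ (k i) t) (ρ (k i) τ) (ρ (k l) t)
    have t2 := krDist_triangle (ρ (k i) τ) (ν ⟨τ, hτ'⟩) (ρ (k l) t)
    have t3 := krDist_triangle (ν ⟨τ, hτ'⟩) (ρ (k l) τ) (ρ (k l) t)
    linarith
  -- The curves along `k` are now uniformly Cauchy, so any weak cluster point at time `t` is the
  -- limit. The subsequence `l t` may depend on `t`, since it only identifies that limit.
  have hcluster : ∀ t, ∃ (μ : FiniteMeasure (Torus d)) (l : ℕ → ℕ), StrictMono l ∧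
      Tendsto (fun i => ρ (k (l i)) t) atTop (𝓝 μ) := by
    intro t
    obtain ⟨μ, l, hl, hμ⟩ := exists_subseq_tendsto_of_mass_le B
      (fun n (_ : Unit) => ρ (k n) t) fun n _ => hB _ _
    exact ⟨μ (), l, hl, hμ ()⟩
  choose μ l hl hμ using hcluster
  refine ⟨μ, k, hk, fun δ hδ => ?_⟩
  obtain ⟨i₀, hi₀⟩ := hcauchy (δ / 2) (by positivity)
  refine ⟨i₀, fun i hi t => lt_of_le_of_lt ?_ (half_lt_self hδ)⟩
  have hlim2 := tendsto_krDist_of_tendsto (hμ t)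
  refine ge_of_tendsto (by simpa using hlim2.const_add (δ / 2)) ?_
  filter_upwards [eventually_ge_atTop i₀] with q hq
  refine (krDist_triangle _ (ρ (k (l t q)) t) _).trans ?_
  gcongr
  exact hi₀ _ _ hi (hq.trans ((hl t).id_le q)) t

/-- Compactness, absolute continuity of the limit and conservation of mass for curves of measures
whose metric speed is equi-integrable. -/
theorem exists_subseq_krAbsCont (ρ : ℕ → Time a b → FiniteMeasure (Torus d)) (B : ℝ≥0)
    (hB : ∀ n t, (ρ n t).mass ≤ B) (hconst : ∀ n s t, (ρ n s).mass = (ρ n t).mass)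
    (j : ℕ → Time a b → ℝ≥0∞) (A : ℝ≥0)
    (hui : ∀ K : ℝ≥0, ∃ C : ℝ≥0, ∀ n (S : Set (Time a b)), MeasurableSet S →
      K * ∫⁻ r in S, j n r ∂(timeVol a b) ≤ A + C * timeVol a b S)
    (hkr : ∀ n s t, s ≤ t →
      ENNReal.ofReal (krDist (ρ n t) (ρ n s)) ≤ ∫⁻ r in Set.Icc s t, j n r ∂(timeVol a b)) :
    ∃ (μ : Time a b → FiniteMeasure (Torus d)) (k : ℕ → ℕ), StrictMono k ∧ KRAbsCont μ ∧
      (∀ t, Tendsto (fun i => ρ (k i) t) atTop (𝓝 (μ t))) ∧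
      (∀ δ : ℝ, 0 < δ → ∃ i₀, ∀ i, i₀ ≤ i → ∀ t, krDist (ρ (k i) t) (μ t) < δ) ∧
      (∀ s t, (μ s).mass = (μ t).mass) := by
  obtain ⟨h, k₁, hh, hk₁, hhj⟩ := exists_limit_density j A hui
  obtain ⟨μ, k₂, hk₂, hunif⟩ := exists_subseq_curves (fun n => ρ (k₁ n)) B (fun n => hB _)
    fun δ hδ => equicontinuous_of_equiintegrable (fun n => ρ (k₁ n)) (fun n => j (k₁ n)) A
      (fun K => (hui K).imp fun C hC n => hC (k₁ n)) (fun n => hkr _) hδ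
  have hlim : ∀ t, Tendsto (fun i => ρ (k₁ (k₂ i)) t) atTop (𝓝 (μ t)) := by
    intro t
    refine tendsto_of_tendsto_krDist (fun n => hB _ t) (Metric.tendsto_atTop.2 fun δ hδ => ?_)
    obtain ⟨i₀, hi₀⟩ := hunif δ hδ
    refine ⟨i₀, fun i hi => ?_⟩
    rw [Real.dist_eq, sub_zero, abs_of_nonneg (krDist_nonneg _ _)]
    exact hi₀ i hi t
  refine ⟨μ, k₁ ∘ k₂, hk₁.comp hk₂, ⟨h, hh.integrableOn, fun s t hst => ?_⟩, hlim, hunif,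
    fun s t => ?_⟩
  · refine le_of_forall_pos_lt_add fun δ hδ => ?_
    suffices hle : krDist (μ t) (μ s) - δ / 2 ≤ ∫ r in (s : ℝ)..t, h r by linarith
    -- The density `h` was extracted along `k₁` only. A lower bound that holds frequently along `k₁`
    -- is enough, so it may be checked along the further subsequence `k₂`.
    refine hhj s t hst _ (hk₂.tendsto_atTop.frequently (Eventually.frequently ?_))
    obtain ⟨i₀, hi₀⟩ := hunif (δ / 4) (by positivity)
    filter_upwards [eventually_ge_atTop i₀] with i hi
    refine le_trans (ENNReal.ofReal_le_ofReal ?_) (hkr (k₁ (k₂ i)) s t hst)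
    have h1 := hi₀ i hi t
    have h2 := hi₀ i hi s
    rw [krDist_comm] at h1
    have t1 := krDist_triangle (μ t) (ρ (k₁ (k₂ i)) t) (μ s)
    have t2 := krDist_triangle (ρ (k₁ (k₂ i)) t) (ρ (k₁ (k₂ i)) s) (μ s)
    linarith
  · exact tendsto_nhds_unique (hlim s).mass ((hlim t).mass.congr fun i => hconst _ _ _)

end Curves

/-! ### Weak derivatives of absolutely continuous curves in a dual space -/

section WeakDerivative

lemma absolutelyContinuousOnInterval_of_dist_le {f H : ℝ → ℝ} {a b C : ℝ} (hC : 0 ≤ C)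
    (hH : AbsolutelyContinuousOnInterval H a b)
    (h : ∀ x ∈ Set.uIcc a b, ∀ y ∈ Set.uIcc a b, dist (f x) (f y) ≤ C * dist (H x) (H y)) :
    AbsolutelyContinuousOnInterval f a b := by
  rw [absolutelyContinuousOnInterval_iff] at hH ⊢
  intro ε hε
  obtain ⟨δ, hδ, hδ'⟩ := hH (ε / (C + 1)) (by positivity)
  refine ⟨δ, hδ, fun I hI hsum => ?_⟩
  have h1 := hδ' I hI hsum
  calc ∑ i ∈ Finset.range I.1, dist (f (I.2 i).1) (f (I.2 i).2)
      ≤ ∑ i ∈ Finset.range I.1, C * dist (H (I.2 i).1) (H (I.2 i).2) :=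
        Finset.sum_le_sum fun i hi => h _ (hI.1 i hi).1 _ (hI.1 i hi).2
    _ = C * ∑ i ∈ Finset.range I.1, dist (H (I.2 i).1) (H (I.2 i).2) := by rw [Finset.mul_sum]
    _ ≤ C * (ε / (C + 1)) := by gcongr
    _ < ε := by
        rw [mul_div_assoc', div_lt_iff₀ (by positivity)]
        linarith

variable {E : Type*} [NormedAddCommGroup E] [NormedSpace ℝ E]

/-- A curve in a dual space dominated by a real function `H` has, wherever `H` is differentiable,
a bounded functional which computes all existing weak-* derivatives. -/
lemma exists_dual_eq_deriv [TopologicalSpace.SeparableSpace E] {U : ℝ → StrongDual ℝ E}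
    {H : ℝ → ℝ} {H' t : ℝ} (hH : HasDerivAt H H' t)
    (hU : ∀ᶠ r in 𝓝 t, ‖U r - U t‖ ≤ |H r - H t|) :
    ∃ L : StrongDual ℝ E, ‖L‖ ≤ |H'| + 1 ∧
      ∀ φ, DifferentiableAt ℝ (fun r => U r φ) t → L φ = deriv (fun r => U r φ) t := by
  have hslope := hasDerivAt_iff_tendsto_slope.1 hH
  have hseq : Tendsto (fun n : ℕ => t + 1 / ((n : ℝ) + 1)) atTop (𝓝[≠] t) := by
    refine tendsto_nhdsWithin_iff.2 ⟨?_, Eventually.of_forall fun n => ?_⟩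
    · simpa using (tendsto_one_div_add_atTop_nhds_zero_nat (𝕜 := ℝ)).const_add t
    · have : (0 : ℝ) < 1 / ((n : ℝ) + 1) := by positivity
      exact (by linarith : t < t + 1 / ((n : ℝ) + 1)).ne'
  let S : ℝ → StrongDual ℝ E := fun r => (r - t)⁻¹ • (U r - U t)
  have hbound : ∀ᶠ r in 𝓝[≠] t, ‖S r‖ ≤ |H'| + 1 := by
    filter_upwards [hslope.abs.eventually_lt_const (lt_add_one _), hU.filter_mono nhdsWithin_le_nhds]
      with r h1 h2
    refine le_trans ?_ h1.le
    rw [norm_smul, slope_def_field, abs_div, norm_inv, Real.norm_eq_abs, div_eq_inv_mul]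
    gcongr
  have hfreq := (hseq.eventually hbound).frequently
  -- Sequential Banach–Alaoglu, by separability of `E`: the difference quotients along `t + 1/(n+1)`
  -- have a weak-* limit point, which must agree with every derivative that exists.
  obtain ⟨L, hL, k, hk, hlim⟩ := (WeakDual.isSeqCompact_closedBall ℝ E 0 (|H'| + 1)).subseq_of_frequently_in
    (x := fun n : ℕ => StrongDual.toWeakDual (S (t + 1 / ((n : ℝ) + 1))))
    (hfreq.mono fun n hn => by simpa using hn)
  refine ⟨WeakDual.toStrongDual L, by simpa using hL, fun φ hφ => ?_⟩
  have h1 : Tendsto (fun n => S (t + 1 / ((k n : ℝ) + 1)) φ) atTop (𝓝 (L φ)) :=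
    ((WeakDual.eval_continuous φ).tendsto L).comp hlim
  have h2 := (hasDerivAt_iff_tendsto_slope.1 hφ.hasDerivAt).comp (hseq.comp hk.tendsto_atTop)
  refine tendsto_nhds_unique h1 (h2.congr fun n => ?_)
  simp [S, slope_def_field, div_eq_inv_mul]

variable {a b : ℝ}

lemma exists_Icc_of_isTimeTest (hab : a < b) {η : ℝ → ℝ} (hη : IsTimeTest a b η) :
    ∃ a' b', a < a' ∧ a' ≤ b' ∧ b' < b ∧ ∀ t, t ∉ Set.Ioo a' b' → η t = 0 ∧ deriv η t = 0 := by
  -- The midpoint keeps the set nonempty when `η` vanishes identically.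
  have hK : IsCompact (insert ((a + b) / 2) (tsupport η)) := IsCompact.insert hη.compact _
  have hsub : insert ((a + b) / 2) (tsupport η) ⊆ Set.Ioo a b :=
    Set.insert_subset ⟨by linarith, by linarith⟩ hη.support
  obtain ⟨p, hp, hpl⟩ := hK.exists_isLeast (Set.insert_nonempty _ _)
  obtain ⟨q, hq, hqg⟩ := hK.exists_isGreatest (Set.insert_nonempty _ _)
  have h1 := (hsub hp).1
  have h2 := (hsub hq).2
  have h3 := hpl hq
  refine ⟨(a + p) / 2, (q + b) / 2, by linarith, by linarith, by linarith, fun t ht => ?_⟩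
  have hnot : t ∉ tsupport η := fun h => ht
    ⟨by linarith [hpl (Set.mem_insert_of_mem _ h)], by linarith [hqg (Set.mem_insert_of_mem _ h)]⟩
  exact ⟨image_eq_zero_of_notMem_tsupport hnot,
    image_eq_zero_of_notMem_tsupport fun h => hnot (tsupport_deriv_subset h)⟩

/-- For `c ≥ 0`, a dual norm is at most `c` as soon as the operator bound holds on a dense sequence,
so sublevel sets are countable intersections of measurable sets. -/
lemma measurable_norm_of_measurable_apply {X : Type*} [MeasurableSpace X]
    [TopologicalSpace.SeparableSpace E] {g : X → StrongDual ℝ E}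
    (hg : ∀ φ, Measurable fun t => g t φ) : Measurable fun t => ‖g t‖ := by
  let D := TopologicalSpace.denseSeq E
  refine measurable_of_Iic fun c => ?_
  rcases lt_or_ge c 0 with hc | hc
  · convert MeasurableSet.empty
    ext t
    simp only [Set.mem_preimage, Set.mem_Iic, Set.mem_empty_iff_false, iff_false, not_le]
    exact hc.trans_le (norm_nonneg _)
  · have : (fun t => ‖g t‖) ⁻¹' Set.Iic c = ⋂ i, {t | |g t (D i)| ≤ c * ‖D i‖} := by
      ext t
      simp only [Set.mem_preimage, Set.mem_Iic, Set.mem_iInter, Set.mem_ofPred_eq]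
      refine ⟨fun h i => (g t).le_of_opNorm_le h (D i), fun h => ?_⟩
      refine (g t).opNorm_le_bound hc fun φ => ?_
      exact (TopologicalSpace.denseRange_denseSeq E).induction_on (p := fun φ => ‖g t φ‖ ≤ c * ‖φ‖)
        φ (isClosed_le (by fun_prop) (by fun_prop)) h
    rw [this]
    exact MeasurableSet.iInter fun i =>
      measurableSet_le (continuous_abs.measurable.comp (hg _)) measurable_const

/-- Absolutely continuous curves in the dual of a separable space have a weak-* derivative. -/
theorem exists_weakStar_derivative [TopologicalSpace.SeparableSpace E] (hab : a < b)
    (u : Time a b → StrongDual ℝ E) (h : ℝ → ℝ) (hh : IntegrableOn h (Set.Ioo a b))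
    (hu : ∀ s t : Time a b, s ≤ t → ‖u t - u s‖ ≤ ∫ r in (s : ℝ)..t, h r) :
    ∃ g : Time a b → StrongDual ℝ E, (∀ φ, Measurable fun t => g t φ) ∧
      Integrable (fun t => ‖g t‖) (timeVol a b) ∧
      ∀ (φ : E) (η : ℝ → ℝ), IsTimeTest a b η →
        ∫ t, deriv η t * u t φ ∂(timeVol a b) = -∫ t, η t * g t φ ∂(timeVol a b) := by
  let U : ℝ → StrongDual ℝ E := fun t => if ht : t ∈ Set.Ioo a b then u ⟨t, ht⟩ else 0
  have hUu : ∀ t : Time a b, U t = u t := fun t => dif_pos t.2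
  have hint : IntervalIntegrable h volume a b := by
    rwa [intervalIntegrable_iff_integrableOn_Ioo_of_le hab.le]
  let H : ℝ → ℝ := fun t => ∫ r in a..t, h r
  have hHAC : AbsolutelyContinuousOnInterval H a b :=
    hint.absolutelyContinuousOnInterval_intervalIntegral (Set.left_mem_uIcc)
  have hHsub : ∀ s t : Time a b, ∫ r in (s : ℝ)..t, h r = H t - H s := by
    intro s t
    refine (intervalIntegral.integral_interval_sub_left (hint.mono_set ?_) (hint.mono_set ?_)).symm
    · rw [Set.uIcc_of_le t.2.1.le, Set.uIcc_of_le hab.le]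
      exact Set.Icc_subset_Icc_right t.2.2.le
    · rw [Set.uIcc_of_le s.2.1.le, Set.uIcc_of_le hab.le]
      exact Set.Icc_subset_Icc_right s.2.2.le
  have hUle : ∀ s ∈ Set.Ioo a b, ∀ t ∈ Set.Ioo a b, s ≤ t → ‖U t - U s‖ ≤ H t - H s := by
    intro s hs t ht hst
    rw [hUu ⟨t, ht⟩, hUu ⟨s, hs⟩]
    exact (hu ⟨s, hs⟩ ⟨t, ht⟩ hst).trans_eq (hHsub ⟨s, hs⟩ ⟨t, ht⟩)
  have hUabs : ∀ s ∈ Set.Ioo a b, ∀ t ∈ Set.Ioo a b, ‖U t - U s‖ ≤ |H t - H s| := by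
    intro s hs t ht
    rcases le_total s t with hst | hst
    · exact (hUle s hs t ht hst).trans (le_abs_self _)
    · rw [norm_sub_rev, abs_sub_comm]
      exact (hUle t ht s hs hst).trans (le_abs_self _)
  -- `H` and `U φ + ‖φ‖ H` are both monotone, because `H` dominates the increments of `U`. By
  -- Lebesgue's theorem both are differentiable almost everywhere, hence so is `U φ`.
  have hdiff : ∀ φ, ∀ᵐ t ∂(volume.restrict (Set.Ioo a b)),
      DifferentiableAt ℝ (fun r => U r φ) t := by
    intro φ
    have hm1 : MonotoneOn H (Set.Ioo a b) := fun s hs t ht hst =>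
      sub_nonneg.1 ((norm_nonneg _).trans (hUle s hs t ht hst))
    have hm2 : MonotoneOn (fun t => U t φ + ‖φ‖ * H t) (Set.Ioo a b) := by
      intro s hs t ht hst
      have h1 := (U t - U s).le_opNorm φ
      have h2 := mul_le_mul_of_nonneg_right (hUle s hs t ht hst) (norm_nonneg φ)
      rw [sub_apply, Real.norm_eq_abs] at h1
      have h3 := (abs_le.1 h1).1
      simp only
      linarith
    filter_upwards [hm1.ae_differentiableWithinAt measurableSet_Ioo,
      hm2.ae_differentiableWithinAt measurableSet_Ioo, ae_restrict_mem measurableSet_Ioo]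
      with t h1 h2 ht
    have hn := Ioo_mem_nhds ht.1 ht.2
    have := (h2.differentiableAt hn).sub ((h1.differentiableAt hn).const_mul ‖φ‖)
    refine this.congr_of_eventuallyEq (Eventually.of_forall fun r => ?_)
    simp
  let D := TopologicalSpace.denseSeq E
  -- A common null set is available only for countably many `φ`, hence the dense sequence. It
  -- settles measurability of `g`; in the final identity each `φ` brings its own null set from
  -- `hdiff`.
  have hgood : ∀ᵐ t : Time a b ∂(timeVol a b),
      HasDerivAt H (h t) t ∧ ∀ i, DifferentiableAt ℝ (fun r => U r (D i)) t := by
    rw [← (MeasurableEmbedding.subtype_coe (measurableSet_Ioo (a := a) (b := b))).ae_map_iff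
      (p := fun t : ℝ => HasDerivAt H (h t) t ∧ ∀ i, DifferentiableAt ℝ (fun r => U r (D i)) t)]
    rw [show (timeVol a b).map Subtype.val = _ from map_val_timeVol]
    have h1 := ae_restrict_of_ae (s := Set.Ioo a b) hint.ae_hasDerivAt_integral
    filter_upwards [h1, ae_restrict_mem measurableSet_Ioo, ae_all_iff.2 fun i => hdiff (D i)]
      with t h1 ht h2
    have htI : t ∈ Set.uIcc a b := by
      rw [Set.uIcc_of_le hab.le]; exact Set.Ioo_subset_Icc_self ht
    exact ⟨h1 htI a Set.left_mem_uIcc, h2⟩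
  obtain ⟨G, hGsub, hGm, hG⟩ : ∃ G ⊆ {t : Time a b | HasDerivAt H (h t) t ∧
      ∀ i, DifferentiableAt ℝ (fun r => U r (D i)) t}, MeasurableSet G ∧
        ∀ᵐ t ∂(timeVol a b), t ∈ G := by
    obtain ⟨G, h1, h2, h3⟩ := exists_measurable_superset_of_null (ae_iff.1 hgood)
    refine ⟨Gᶜ, ?_, h2.compl, ?_⟩
    · intro t ht
      by_contra hcon
      exact ht (h1 hcon)
    · rw [ae_iff]
      simpa using h3
  have hL : ∀ t : Time a b, ∃ L : StrongDual ℝ E, t ∈ G → ‖L‖ ≤ |h t| + 1 ∧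
      ∀ φ, DifferentiableAt ℝ (fun r => U r φ) t → L φ = deriv (fun r => U r φ) t := by
    intro t
    by_cases ht : t ∈ G
    · obtain ⟨L, hL⟩ := exists_dual_eq_deriv (U := U) (hGsub ht).1
        (by filter_upwards [Ioo_mem_nhds t.2.1 t.2.2] with r hr using hUabs t t.2 r hr)
      exact ⟨L, fun _ => hL⟩
    · exact ⟨0, fun h => absurd h ht⟩
  choose L hL using hL
  classical
  let g : Time a b → StrongDual ℝ E := fun t => if t ∈ G then L t else 0
  have hgD : ∀ i, Measurable fun t => g t (D i) := by
    intro i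
    have : (fun t => g t (D i)) =
        G.indicator fun t : Time a b => deriv (fun r => U r (D i)) t := by
      ext t
      by_cases ht : t ∈ G
      · simp only [g, if_pos ht, Set.indicator_of_mem ht]
        exact (hL t ht).2 _ ((hGsub ht).2 i)
      · simp [g, ht]
    rw [this]
    exact ((measurable_deriv _).comp measurable_subtype_coe).indicator hGm
  have hgm : ∀ φ, Measurable fun t => g t φ := by
    intro φ
    obtain ⟨x, hx, hlim⟩ := mem_closure_iff_seq_limit.1
      ((TopologicalSpace.denseRange_denseSeq E).closure_range ▸ Set.mem_univ φ)
    refine measurable_of_tendsto_metrizable (f := fun n t => g t (x n)) (fun n => ?_)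
      (tendsto_pi_nhds.2 fun t => ((g t).continuous.tendsto φ).comp hlim)
    obtain ⟨i, hi⟩ := hx n
    simp only [← hi]
    exact hgD i
  refine ⟨g, hgm, ?_, fun φ η hη => ?_⟩
  · have hhint : Integrable (fun t : Time a b => |h t| + 1) (timeVol a b) :=
      (((integrable_timeVol_iff h).2 hh).abs).add (integrable_const 1)
    refine hhint.mono' (measurable_norm_of_measurable_apply hgm).aestronglyMeasurable ?_
    filter_upwards [hG] with t ht
    rw [norm_norm]
    simp only [g, if_pos ht]
    exact (hL t ht).1
  -- On a compact subinterval containing the support of `η`, both `η` and `U φ` are absolutely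
  -- continuous, and the boundary terms of the integration by parts vanish.
  · obtain ⟨a', b', ha', hab', hb', hzero⟩ := exists_Icc_of_isTimeTest hab hη
    have hsub : Set.Icc a' b' ⊆ Set.Ioo a b := fun t ht =>
      ⟨ha'.trans_le ht.1, ht.2.trans_lt hb'⟩
    have hred : ∀ f : ℝ → ℝ, (∀ t, t ∉ Set.Ioo a' b' → f t = 0) →
        ∫ t : Time a b, f t ∂(timeVol a b) = ∫ t in a'..b', f t := by
      intro f hf
      rw [integral_timeVol, intervalIntegral.integral_of_le hab', integral_Ioc_eq_integral_Ioo]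
      refine setIntegral_eq_of_subset_of_forall_sdiff_eq_zero measurableSet_Ioo
        (Set.Ioo_subset_Icc_self.trans hsub) fun t ht => hf t ht.2
    have hfAC : AbsolutelyContinuousOnInterval (fun t => U t φ) a' b' := by
      refine absolutelyContinuousOnInterval_of_dist_le (norm_nonneg φ) (hHAC.mono ?_) ?_
      · rw [Set.uIcc_of_le hab', Set.uIcc_of_le hab.le]
        exact hsub.trans Set.Ioo_subset_Icc_self
      · rw [Set.uIcc_of_le hab']
        intro x hx y hy
        rw [Real.dist_eq, Real.dist_eq, mul_comm, ← Real.norm_eq_abs,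
          ← sub_apply]
        exact (U x - U y).le_of_opNorm_le (hUabs y (hsub hy) x (hsub hx)) φ
    have hηAC : AbsolutelyContinuousOnInterval η a' b' :=
      (hη.smooth.of_le (by simp)).contDiffOn.absolutelyContinuousOnInterval
    have h1 : ∫ t, deriv η t * u t φ ∂(timeVol a b) = ∫ t in a'..b', deriv η t * U t φ := by
      rw [← hred _ fun t ht => by rw [(hzero t ht).2, zero_mul]]
      simp only [hUu]
    have h2 : ∫ t, η t * g t φ ∂(timeVol a b) =
        ∫ t in a'..b', η t * deriv (fun r => U r φ) t := by
      rw [← hred _ fun t ht => by rw [(hzero t ht).1, zero_mul]]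
      have hdφ := hdiff φ
      rw [← map_val_timeVol, (MeasurableEmbedding.subtype_coe
        (measurableSet_Ioo (a := a) (b := b))).ae_map_iff] at hdφ
      refine integral_congr_ae ?_
      filter_upwards [hdφ, hG] with t h1 h2
      simp only [g, if_pos h2, (hL t h2).2 φ h1]
    rw [h1, h2, hηAC.integral_mul_deriv_eq_deriv_mul hfAC,
      (hzero a' fun h => lt_irrefl _ h.1).1, (hzero b' fun h => lt_irrefl _ h.2).1]
    simp

end WeakDerivative

/-! ### Absolutely continuous curves of measures belong to `W^{1,1}` -/

section Torus

variable {d : ℕ}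

/-- Subtracting the nearest integer in each coordinate gives lifts at Euclidean distance equal to
the flat distance. Lipschitz bounds on the torus thereby reduce to the mean value inequality along a
segment in `ℝ^d`. -/
lemma exists_lifts (x y : Torus d) : ∃ p q : EuclideanSpace ℝ (Fin d),
    toTorus p = x ∧ toTorus q = y ∧ ‖p - q‖ = flatDist x y := by
  have h : ∀ i, ∃ p q : ℝ, (p : UnitAddCircle) = x i ∧ (q : UnitAddCircle) = y i ∧
      |p - q| = ‖x i - y i‖ := by
    intro i
    obtain ⟨v, hv⟩ := QuotientAddGroup.mk_surjective (y i)
    obtain ⟨w, hw⟩ := QuotientAddGroup.mk_surjective (x i - y i)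
    refine ⟨v + (w - round w), v, ?_, hv, ?_⟩
    · have h0 : ((w - round w : ℝ) : UnitAddCircle) = x i - y i := by
        have h1 : ((round w : ℝ) : UnitAddCircle) = 0 :=
          (AddCircle.coe_eq_zero_iff 1).2 ⟨round w, by simp⟩
        rw [AddCircle.coe_sub, h1, sub_zero]
        exact hw
      rw [AddCircle.coe_add, h0]
      rw [show (v : UnitAddCircle) = y i from hv]
      abel
    · rw [← hw]
      rw [show ‖(QuotientAddGroup.mk w : UnitAddCircle)‖ = _ from UnitAddCircle.norm_eq]
      congr 1
      ring
  choose p q hp hq hpq using h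
  refine ⟨WithLp.toLp 2 p, WithLp.toLp 2 q, funext hp, funext hq, ?_⟩
  rw [EuclideanSpace.norm_eq, flatDist]
  congr 1
  refine Finset.sum_congr rfl fun i _ => ?_
  rw [← hpq i]
  simp

lemma C1Torus.abs_sub_le (φ : C1Torus d) (x y : Torus d) :
    |φ.fn x - φ.fn y| ≤ ‖φ.grad‖ * flatDist x y := by
  obtain ⟨p, q, rfl, rfl, h⟩ := exists_lifts x y
  rw [← h]
  refine Convex.norm_image_sub_le_of_norm_hasFDerivWithin_le
    (f := fun p => φ.fn (toTorus p)) (s := Set.univ)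
    (fun p _ => (φ.2 p).hasFDerivAt.hasFDerivWithinAt) (fun p _ => ?_) convex_univ
    (Set.mem_univ q) (Set.mem_univ p)
  rw [LinearIsometryEquiv.norm_map]
  exact φ.grad.norm_coe_le_norm _

/-- A function of positive `C¹` norm, divided by that norm, is a Kantorovich–Rubinstein test
function. -/
lemma norm_toDual_sub_le (μ ν : FiniteMeasure (Torus d)) :
    ‖toDual μ - toDual ν‖ ≤ krDist μ ν := by
  refine ContinuousLinearMap.opNorm_le_bound _ (krDist_nonneg _ _) fun φ => ?_
  show |∫ x, φ.fn x ∂(μ : Measure (Torus d)) - ∫ x, φ.fn x ∂(ν : Measure (Torus d))| ≤ _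
  have h1 : ‖φ.fn‖ ≤ ‖φ‖ := by rw [φ.norm_eq]; exact le_max_left _ _
  have h2 : ‖φ.grad‖ ≤ ‖φ‖ := by rw [φ.norm_eq]; exact le_max_right _ _
  rcases (norm_nonneg φ).eq_or_lt with h0 | h0
  · have a1 := abs_integral_le_norm_mul_mass φ.fn μ
    have a2 := abs_integral_le_norm_mul_mass φ.fn ν
    have : ‖φ.fn‖ = 0 := le_antisymm (h1.trans h0.ge) (norm_nonneg _)
    rw [this, zero_mul] at a1 a2
    rw [abs_nonpos_iff.1 a1, abs_nonpos_iff.1 a2, ← h0]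
    simp
  · have hψ : ‖φ‖⁻¹ • φ.fn ∈ krTests d := by
      refine ⟨fun x => ?_, fun x y => ?_⟩
      · rw [ContinuousMap.smul_apply, smul_eq_mul, abs_mul, abs_inv, abs_norm,
          inv_mul_le_iff₀ h0, mul_one]
        exact (φ.fn.norm_coe_le_norm x).trans h1
      · rw [ContinuousMap.smul_apply, ContinuousMap.smul_apply, ← smul_sub, smul_eq_mul, abs_mul,
          abs_inv, abs_norm, inv_mul_le_iff₀ h0]
        exact (φ.abs_sub_le x y).trans (mul_le_mul_of_nonneg_right h2 (flatDist_nonneg x y))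
    have := abs_sub_le_krDist hψ μ ν
    simp only [ContinuousMap.smul_apply, smul_eq_mul] at this
    rw [integral_const_mul, integral_const_mul, ← mul_sub, abs_mul, abs_inv, abs_norm, inv_mul_le_iff₀ h0] at this
    rwa [mul_comm]

instance : TopologicalSpace.SeparableSpace (C1Torus d) :=
  inferInstanceAs (TopologicalSpace.SeparableSpace ↥(c1Submodule d))

/-- The primitive of `h` controls the increments in dual norm, so the curve is norm continuous,
hence strongly measurable although the dual need not be separable. Constant mass bounds its norm,
which gives Bochner integrability. -/
theorem memW11KR_of_krAbsCont {a b : ℝ} (hab : a < b) {μ : Time a b → FiniteMeasure (Torus d)}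
    (h : KRAbsCont μ) (hμ : ∀ s t, (μ s).mass = (μ t).mass) : MemW11KR μ := by
  obtain ⟨h, hh, hμh⟩ := h
  have hu : ∀ s t : Time a b, s ≤ t → ‖toDual (μ t) - toDual (μ s)‖ ≤ ∫ r in (s : ℝ)..t, h r :=
    fun s t hst => (norm_toDual_sub_le _ _).trans (hμh s t hst)
  refine ⟨?_, exists_weakStar_derivative hab _ h hh hu⟩
  have hcont : Continuous fun t => toDual (μ t) := by
    refine continuous_iff_continuousAt.2 fun s => tendsto_iff_norm_sub_tendsto_zero.2 ?_
    have hint : IntervalIntegrable h volume a b := by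
      rwa [intervalIntegrable_iff_integrableOn_Ioo_of_le hab.le]
    have hs : (s : ℝ) ∈ Set.uIcc a b := by
      rw [Set.uIcc_of_le hab.le]; exact Set.Ioo_subset_Icc_self s.2
    have h1 := (hint.absolutelyContinuousOnInterval_intervalIntegral hs).continuousOn
      |>.continuousAt (x := (s : ℝ)) (by
        rw [Set.uIcc_of_le hab.le]; exact Icc_mem_nhds s.2.1 s.2.2)
    have h2 : Tendsto (fun t : Time a b => |∫ r in (s : ℝ)..t, h r|) (𝓝 s) (𝓝 0) := by
      have := (h1.tendsto.comp (continuous_subtype_val.tendsto s)).abs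
      simpa using this
    refine squeeze_zero (fun t => norm_nonneg _) (fun t => ?_) h2
    rcases le_total s t with hst | hst
    · exact (hu s t hst).trans (le_abs_self _)
    · rw [norm_sub_rev, intervalIntegral.integral_symm, abs_neg]
      exact (hu t s hst).trans (le_abs_self _)
  let t₀ : Time a b := ⟨(a + b) / 2, by constructor <;> linarith⟩
  refine (integrable_const ((μ t₀).mass : ℝ)).mono' hcont.aestronglyMeasurable
    (Eventually.of_forall fun t => ?_)
  rw [hμ t₀ t]
  exact LinearMap.mkContinuous_norm_le _ (NNReal.coe_nonneg _) _

end Torus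

/-! ### Weak convergence of space-time measures -/

section SpaceTime

open ProbabilityTheory

/-- The measure of a closed set is a limit of integrals of continuous functions, and closed sets
form a generating π-system. This makes a curve of measures a kernel. -/
lemma measurable_toMeasure_of_integral {X T : Type*} [MeasurableSpace T] [TopologicalSpace X]
    [HasOuterApproxClosed X] [MeasurableSpace X] [BorelSpace X] {μ : T → FiniteMeasure X}
    (h : ∀ f : X →ᵇ ℝ, Measurable fun t => ∫ x, f x ∂(μ t : Measure X)) :
    Measurable fun t => (μ t : Measure X) := by
  have hcl : ∀ F : Set X, IsClosed F → Measurable fun t => (μ t : Measure X) F := by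
    intro F hF
    refine measurable_of_tendsto_metrizable (f := fun n t =>
      ∫⁻ x, (hF.apprSeq n x : ℝ≥0∞) ∂(μ t : Measure X)) (fun n => ?_)
      (tendsto_pi_nhds.2 fun t => HasOuterApproxClosed.tendsto_lintegral_apprSeq hF _)
    let f : X →ᵇ ℝ := BoundedContinuousFunction.comp (fun x : ℝ≥0 => (x : ℝ))
      (LipschitzWith.of_dist_le_mul (K := 1) fun x y => by simp [NNReal.dist_eq, Real.dist_eq]) (hF.apprSeq n)
    have : (fun t => ∫⁻ x, (hF.apprSeq n x : ℝ≥0∞) ∂(μ t : Measure X)) =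
        fun t => ENNReal.ofReal (∫ x, f x ∂(μ t : Measure X)) := by
      ext t
      rw [ofReal_integral_eq_lintegral_ofReal (f.integrable _)
        (Eventually.of_forall fun x => (hF.apprSeq n x).2)]
      simp [f]
    rw [this]
    exact (h f).ennreal_ofReal
  exact Measurable.measure_of_isPiSystem (BorelSpace.measurable_eq.trans
    borel_eq_generateFrom_isClosed) isPiSystem_isClosed hcl (hcl _ isClosed_univ)

variable {d : ℕ} {a b : ℝ}

lemma spaceTime_eq_compProd {μ : Time a b → FiniteMeasure (Torus d)}
    (hμ : Measurable fun t => (μ t : Measure (Torus d))) {B : ℝ≥0} (hB : ∀ t, (μ t).mass ≤ B) :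
    ∃ κ : Kernel (Time a b) (Torus d), IsFiniteKernel κ ∧ (∀ t, κ t = μ t) ∧
      spaceTime μ = (timeVol a b).compProd κ := by
  let κ : Kernel (Time a b) (Torus d) := ⟨fun t => (μ t : Measure (Torus d)), hμ⟩
  have hκ : IsFiniteKernel κ := ⟨B, ENNReal.coe_lt_top, fun t => by
    show (μ t : Measure (Torus d)) Set.univ ≤ B
    rw [← FiniteMeasure.ennreal_mass]
    exact ENNReal.coe_le_coe.2 (hB t)⟩
  refine ⟨κ, hκ, fun t => rfl, ?_⟩
  have happly : ∀ (t : Time a b) {s : Set (Time a b × Torus d)}, MeasurableSet s →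
      (μ t : Measure (Torus d)).map (fun x => (t, x)) s = κ t (Prod.mk t ⁻¹' s) := fun t s hs =>
    Measure.map_apply measurable_prodMk_left hs
  have hm : Measurable fun t => (μ t : Measure (Torus d)).map fun x => (t, x) := by
    refine Measure.measurable_of_measurable_coe _ fun s hs => ?_
    simp only [happly _ hs]
    exact Kernel.measurable_kernel_prodMk_left hs
  ext s hs
  rw [spaceTime, Measure.bind_apply hs hm.aemeasurable, Measure.compProd_apply hs]
  simp only [happly _ hs]

/-- Weak convergence at all times implies weak convergence of the space-time measures. -/
theorem tendstoWeakly_spaceTime {ρ : ℕ → Time a b → FiniteMeasure (Torus d)}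
    {μ : Time a b → FiniteMeasure (Torus d)} {B : ℝ≥0} (hB : ∀ n t, (ρ n t).mass ≤ B)
    (hρ : ∀ n, Continuous (ρ n)) (hlim : ∀ t, Tendsto (fun n => ρ n t) atTop (𝓝 (μ t))) :
    TendstoWeakly (fun n => spaceTime (ρ n)) (spaceTime μ) := by
  have hBμ : ∀ t, (μ t).mass ≤ B := fun t => le_of_tendsto' (hlim t).mass fun n => hB n t
  have hmρ : ∀ n (f : Torus d →ᵇ ℝ), Measurable fun t => ∫ x, f x ∂(ρ n t : Measure (Torus d)) :=
    fun n f => ((FiniteMeasure.continuous_integral_boundedContinuousFunction f).comp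
      (hρ n)).measurable
  have hmμ : ∀ f : Torus d →ᵇ ℝ, Measurable fun t => ∫ x, f x ∂(μ t : Measure (Torus d)) :=
    fun f => measurable_of_tendsto_metrizable (fun n => hmρ n f) (tendsto_pi_nhds.2 fun t =>
      FiniteMeasure.tendsto_iff_forall_integral_tendsto.1 (hlim t) f)
  have hκρ := fun n => spaceTime_eq_compProd (measurable_toMeasure_of_integral (hmρ n)) (hB n)
  choose κ hκ hκe hκs using hκρ
  obtain ⟨κ₀, hκ₀, hκ₀e, hκ₀s⟩ :=
    spaceTime_eq_compProd (measurable_toMeasure_of_integral hmμ) hBμ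
  intro ψ
  simp only [hκs, hκ₀s]
  rw [Measure.integral_compProd (ψ.integrable _)]
  simp only [Measure.integral_compProd (ψ.integrable _)]
  refine tendsto_integral_of_dominated_convergence (fun _ => ‖ψ‖ * B) (fun n => ?_)
    (integrable_const _) (fun n => Eventually.of_forall fun t => ?_)
    (Eventually.of_forall fun t => ?_)
  · exact (StronglyMeasurable.integral_kernel_prod_right'
      ψ.continuous.stronglyMeasurable).aestronglyMeasurable
  · have h1 := norm_integral_le_of_norm_le_const (μ := κ n t) (f := fun x => ψ (t, x)) (C := ‖ψ‖)
      (Eventually.of_forall fun x => ψ.norm_coe_le_norm _)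
    refine h1.trans (mul_le_mul_of_nonneg_left ?_ (norm_nonneg _))
    rw [hκe]
    exact hB n t
  · simp only [hκe, hκ₀e]
    exact FiniteMeasure.tendsto_iff_forall_integral_tendsto.1 (hlim t)
      (ψ.compContinuous ⟨fun x => (t, x), by fun_prop⟩)

end SpaceTime

/-! ### Continuous functions with an integrable distributional derivative -/

section DuBoisReymond

variable {a b : ℝ}

/-- A smooth step of width `1 / k` at `s`. -/
noncomputable def smoothStep (k s r : ℝ) : ℝ := Real.smoothTransition (k * (r - s))

lemma contDiff_smoothStep (k s : ℝ) : ContDiff ℝ (⊤ : ℕ∞) (smoothStep k s) :=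
  Real.smoothTransition.contDiff.comp (by fun_prop)

lemma smoothStep_of_le {k s r : ℝ} (hk : 0 < k) (h : r ≤ s) : smoothStep k s r = 0 :=
  Real.smoothTransition.zero_of_nonpos (mul_nonpos_of_nonneg_of_nonpos hk.le (by linarith))

lemma smoothStep_of_ge {k s r : ℝ} (hk : 0 < k) (h : s + 1 / k ≤ r) : smoothStep k s r = 1 := by
  refine Real.smoothTransition.one_of_one_le ?_
  rw [← div_le_iff₀' hk]
  linarith

lemma monotone_smoothStep {k : ℝ} (hk : 0 < k) (s : ℝ) : Monotone (smoothStep k s) :=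
  Real.smoothTransition.monotone.comp fun x y h => by
    have := mul_le_mul_of_nonneg_left (sub_le_sub_right h s) hk.le
    exact this

lemma deriv_smoothStep_eq_zero {k s r : ℝ} (hk : 0 < k) (h : r ∉ Set.Icc s (s + 1 / k)) :
    deriv (smoothStep k s) r = 0 := by
  rw [Set.mem_Icc, not_and_or, not_le, not_le] at h
  rcases h with h | h
  · have : smoothStep k s =ᶠ[𝓝 r] fun _ => 0 := by
      filter_upwards [Iio_mem_nhds h] with x hx using smoothStep_of_le hk (le_of_lt hx)
    rw [this.deriv_eq, deriv_const]
  · have : smoothStep k s =ᶠ[𝓝 r] fun _ => 1 := by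
      filter_upwards [Ioi_mem_nhds h] with x hx using smoothStep_of_ge hk (le_of_lt hx)
    rw [this.deriv_eq, deriv_const]

lemma continuous_deriv_smoothStep (k s : ℝ) : Continuous (deriv (smoothStep k s)) :=
  (contDiff_smoothStep k s).continuous_deriv (by simp)

lemma integrableOn_deriv_smoothStep_mul {f : ℝ → ℝ} (hf : ContinuousOn f (Set.Ioo a b)) {k s : ℝ}
    (hk : 0 < k) (hs : a < s) (hs' : s + 1 / k < b) :
    IntegrableOn (fun r => deriv (smoothStep k s) r * f r) (Set.Ioo a b) := by
  have hsub : Set.Icc s (s + 1 / k) ⊆ Set.Ioo a b := fun r hr =>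
    ⟨hs.trans_le hr.1, hr.2.trans_lt hs'⟩
  refine IntegrableOn.of_forall_sdiff_eq_zero (s := Set.Icc s (s + 1 / k)) ?_ measurableSet_Ioo
    fun r hr => by rw [deriv_smoothStep_eq_zero hk hr.2, zero_mul]
  exact ((continuous_deriv_smoothStep k s).continuousOn.mul (hf.mono hsub)).integrableOn_Icc

/-- The derivative of the step is a nonnegative bump of integral one on `[s, s + 1/(n+1)]`. By the
mean value theorem for integrals, the integral is a value of `f` on that interval. -/
lemma tendsto_integral_deriv_smoothStep {f : ℝ → ℝ} (hf : ContinuousOn f (Set.Ioo a b)) {s : ℝ}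
    (hs : s ∈ Set.Ioo a b) :
    Tendsto (fun n : ℕ => ∫ r in Set.Ioo a b, deriv (smoothStep (n + 1) s) r * f r) atTop
      (𝓝 (f s)) := by
  have hlim : Tendsto (fun n : ℕ => s + 1 / ((n : ℝ) + 1)) atTop (𝓝 s) := by
    simpa using (tendsto_one_div_add_atTop_nhds_zero_nat (𝕜 := ℝ)).const_add s
  have hmv : ∀ n : ℕ, s + 1 / ((n : ℝ) + 1) < b → ∃ c ∈ Set.Icc s (s + 1 / ((n : ℝ) + 1)),
      ∫ r in Set.Ioo a b, deriv (smoothStep (n + 1) s) r * f r = f c := by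
    intro n hn
    have hk : (0 : ℝ) < n + 1 := by positivity
    have hk' : (0 : ℝ) < 1 / (n + 1) := by positivity
    have hsub : Set.Icc s (s + 1 / ((n : ℝ) + 1)) ⊆ Set.Ioo a b := fun r hr =>
      ⟨hs.1.trans_le hr.1, hr.2.trans_lt hn⟩
    have hd := continuous_deriv_smoothStep ((n : ℝ) + 1) s
    obtain ⟨c, hc, hceq⟩ := exists_eq_const_mul_setIntegral_of_nonneg (μ := volume)
      (s := Set.Icc s (s + 1 / ((n : ℝ) + 1))) (f := f) (g := deriv (smoothStep (n + 1) s))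
      (isConnected_Icc (by linarith)) measurableSet_Icc (hf.mono hsub) hd.integrableOn_Icc
      ((hf.mono hsub).mul hd.continuousOn).integrableOn_Icc
      (fun r _ => (monotone_smoothStep hk s).deriv_nonneg)
    have h1 : ∫ r in Set.Icc s (s + 1 / ((n : ℝ) + 1)), deriv (smoothStep (n + 1) s) r = 1 := by
      rw [integral_Icc_eq_integral_Ioc, ← intervalIntegral.integral_of_le (by linarith),
        intervalIntegral.integral_deriv_eq_sub
          (fun x _ => (contDiff_smoothStep _ _).differentiable (by simp) x)
          (hd.intervalIntegrable _ _),
        smoothStep_of_ge hk le_rfl, smoothStep_of_le hk le_rfl, sub_zero]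
    refine ⟨c, hc, ?_⟩
    rw [h1, mul_one] at hceq
    rw [← hceq]
    have := setIntegral_eq_of_subset_of_forall_sdiff_eq_zero (μ := volume) measurableSet_Ioo hsub
      (f := fun r => deriv (smoothStep (n + 1) s) r * f r)
      fun r hr => by rw [deriv_smoothStep_eq_zero hk hr.2, zero_mul]
    rw [this]
    simp only [mul_comm]
  choose! c hc hceq using hmv
  have hev : ∀ᶠ n : ℕ in atTop, s + 1 / ((n : ℝ) + 1) < b := hlim.eventually_lt_const hs.2
  have hclim : Tendsto c atTop (𝓝 s) :=
    tendsto_of_tendsto_of_tendsto_of_le_of_le' tendsto_const_nhds hlim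
      (hev.mono fun n hn => (hc n hn).1) (hev.mono fun n hn => (hc n hn).2)
  refine (((hf.continuousAt (Ioo_mem_nhds hs.1 hs.2)).tendsto.comp hclim)).congr' ?_
  filter_upwards [hev] with n hn using (hceq n hn).symm

/-- A continuous function with integrable distributional derivative is its primitive. -/
theorem sub_eq_integral_of_weak_derivative {f g : Time a b → ℝ} (hf : Continuous f)
    (hg : Integrable g (timeVol a b))
    (h : ∀ η : ℝ → ℝ, IsTimeTest a b η →
      ∫ t, deriv η t * f t ∂(timeVol a b) = ∫ t, η t * g t ∂(timeVol a b))
    {s t : Time a b} (hst : s ≤ t) :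
    f t - f s = -∫ r in Set.Ioc s t, g r ∂(timeVol a b) := by
  let f' : ℝ → ℝ := fun r => if hr : r ∈ Set.Ioo a b then f ⟨r, hr⟩ else 0
  have hf'f : ∀ r : Time a b, f' r = f r := fun r => dif_pos r.2
  have hf' : ContinuousOn f' (Set.Ioo a b) := by
    rw [continuousOn_iff_continuous_domRestrict]
    exact hf.congr fun r => (hf'f r).symm
  have hst' : (s : ℝ) ≤ t := hst
  -- Smooth approximation of the indicator of `(s, t]`, half-open because each step rises to the
  -- right of its base point. Its derivative approximates the Dirac mass at `s` minus the one at
  -- `t`.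
  let η : ℕ → ℝ → ℝ := fun n r => smoothStep (n + 1) s r - smoothStep (n + 1) t r
  have hk : ∀ n : ℕ, (0 : ℝ) < n + 1 := fun n => by positivity
  have hev : ∀ᶠ n : ℕ in atTop, (t : ℝ) + 1 / ((n : ℝ) + 1) < b := by
    have hlim : Tendsto (fun n : ℕ => (t : ℝ) + 1 / ((n : ℝ) + 1)) atTop (𝓝 t) := by
      simpa using (tendsto_one_div_add_atTop_nhds_zero_nat (𝕜 := ℝ)).const_add (t : ℝ)
    exact hlim.eventually_lt_const t.2.2
  have htest : ∀ n : ℕ, (t : ℝ) + 1 / ((n : ℝ) + 1) < b → IsTimeTest a b (η n) := by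
    intro n hn
    have hsupp : tsupport (η n) ⊆ Set.Icc (s : ℝ) (t + 1 / ((n : ℝ) + 1)) := by
      refine closure_minimal (fun r hr => ?_) isClosed_Icc
      by_contra hcon
      refine hr ?_
      have hpos : (0 : ℝ) < 1 / ((n : ℝ) + 1) := by positivity
      rw [Set.mem_Icc, not_and_or, not_le, not_le] at hcon
      rcases hcon with hcon | hcon
      · simp only [η, smoothStep_of_le (hk n) hcon.le,
          smoothStep_of_le (hk n) (hcon.le.trans hst'), sub_zero]
      · simp only [η, smoothStep_of_ge (hk n) hcon.le,
          smoothStep_of_ge (hk n) (show (s : ℝ) + 1 / (n + 1) ≤ r by linarith), sub_self]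
    exact ⟨(contDiff_smoothStep _ _).sub (contDiff_smoothStep _ _),
      isCompact_Icc.of_isClosed_subset (isClosed_tsupport _) hsupp,
      hsupp.trans fun r hr => ⟨s.2.1.trans_le hr.1, hr.2.trans_lt hn⟩⟩
  have hleft : Tendsto (fun n : ℕ => ∫ r, deriv (η n) r * f r ∂(timeVol a b)) atTop
      (𝓝 (f s - f t)) := by
    rw [← hf'f s, ← hf'f t]
    refine ((tendsto_integral_deriv_smoothStep hf' s.2).sub
      (tendsto_integral_deriv_smoothStep hf' t.2)).congr' ?_
    filter_upwards [hev] with n hn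
    rw [← integral_sub (integrableOn_deriv_smoothStep_mul hf' (hk n) s.2.1 (by linarith))
      (integrableOn_deriv_smoothStep_mul hf' (hk n) t.2.1 hn), ← integral_timeVol]
    refine integral_congr_ae (Eventually.of_forall fun r => ?_)
    have hd := fun s => (contDiff_smoothStep ((n : ℝ) + 1) s).differentiable (by simp)
    have : deriv (η n) r = deriv (smoothStep (n + 1) s) r - deriv (smoothStep (n + 1) t) r :=
      deriv_sub (hd s r) (hd t r)
    simp only [this, ← hf'f]
    ring
  have hright : Tendsto (fun n : ℕ => ∫ r, η n r * g r ∂(timeVol a b)) atTop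
      (𝓝 (∫ r in Set.Ioc s t, g r ∂(timeVol a b))) := by
    rw [← integral_indicator measurableSet_Ioc]
    refine tendsto_integral_of_dominated_convergence (fun r => |g r|) (fun n => ?_) hg.abs
      (fun n => Eventually.of_forall fun r => ?_) (Eventually.of_forall fun r => ?_)
    · have hc : Continuous fun r : Time a b => η n r :=
        ((contDiff_smoothStep _ _).sub (contDiff_smoothStep _ _)).continuous.comp
          continuous_subtype_val
      exact hc.aestronglyMeasurable.mul hg.aestronglyMeasurable
    · rw [Real.norm_eq_abs, abs_mul]
      refine mul_le_of_le_one_left (abs_nonneg _) ?_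
      rw [abs_le]
      have h1 := Real.smoothTransition.nonneg ((n + 1) * ((r : ℝ) - s))
      have h2 := Real.smoothTransition.nonneg ((n + 1) * ((r : ℝ) - t))
      have h3 := Real.smoothTransition.le_one ((n + 1) * ((r : ℝ) - s))
      have h4 := Real.smoothTransition.le_one ((n + 1) * ((r : ℝ) - t))
      simp only [η, smoothStep]
      constructor <;> linarith
    · have hstep : ∀ p : Time a b, ∀ᶠ n : ℕ in atTop,
          smoothStep (n + 1) p r = if p < r then 1 else 0 := by
        intro p
        split_ifs with hp
        · have hp' : (0 : ℝ) < (r : ℝ) - p := sub_pos.2 hp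
          have hlim := (tendsto_one_div_add_atTop_nhds_zero_nat (𝕜 := ℝ)).eventually_lt_const hp'
          filter_upwards [hlim] with n hn using smoothStep_of_ge (hk n) (by linarith)
        · exact Eventually.of_forall fun n => smoothStep_of_le (hk n) (not_lt.1 hp)
      refine tendsto_nhds_of_eventually_eq ?_
      filter_upwards [hstep s, hstep t] with n h1 h2
      simp only [η, h1, h2, Set.indicator_apply, Set.mem_Ioc]
      by_cases hs : s < r <;> by_cases ht : t < r
      · simp [hs, ht]
      · simp [hs, ht, not_lt.1 ht]
      · exact absurd (hst.trans_lt ht) hs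
      · simp [hs, ht]
  have heq := tendsto_nhds_unique (hleft.congr' (hev.mono fun n hn => h (η n) (htest n hn))) hright
  linarith

end DuBoisReymond

/-! ### Cubes in the torus -/

section Cubes

/-- Since `q ≤ p + 1`, the arc does not overlap itself, and it corresponds to `[p, q)` in the
fundamental domain `[p, p + 1)`. -/
lemma volume_arc {p q : ℝ} (hq : q ≤ p + 1) :
    MeasurableSet {u : UnitAddCircle | ∃ r ∈ Set.Ico p q, u = (r : UnitAddCircle)} ∧
    volume {u : UnitAddCircle | ∃ r ∈ Set.Ico p q, u = (r : UnitAddCircle)} =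
      ENNReal.ofReal (q - p) := by
  have hset : {u : UnitAddCircle | ∃ r ∈ Set.Ico p q, u = (r : UnitAddCircle)} =
      {u : UnitAddCircle | ((AddCircle.equivIco 1 p u : Set.Ico p (p + 1)) : ℝ) < q} := by
    ext u
    constructor
    · rintro ⟨r, hr, rfl⟩
      have := AddCircle.equivIco_coe_of_mem (p := (1 : ℝ)) (a := p) (y := r) ⟨hr.1, hr.2.trans_le hq⟩
      simpa [this] using hr.2
    · intro hu
      exact ⟨_, ⟨(AddCircle.equivIco 1 p u).2.1, hu⟩,
        ((AddCircle.equivIco 1 p).symm_apply_apply u).symm⟩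
  rw [hset]
  have hmeas : MeasurableSet
      {u : UnitAddCircle | ((AddCircle.equivIco 1 p u : Set.Ico p (p + 1)) : ℝ) < q} :=
    measurableSet_lt (measurable_subtype_coe.comp
      (AddCircle.measurableEquivIco (1 : ℝ) p).measurable) measurable_const
  refine ⟨hmeas, ?_⟩
  rw [← (AddCircle.measurePreserving_mk (1 : ℝ) p).measure_preimage hmeas.nullMeasurableSet,
    Measure.restrict_apply ((AddCircle.measurable_mk' (a := (1 : ℝ))) hmeas), ← Real.volume_Ico]
  refine measure_congr (Filter.eventuallyEq_set.2 ?_)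
  -- The quotient map is measure preserving from `(p, p + 1]`, while arcs are read in `[p, p + 1)`;
  -- the two endpoints are negligible.
  filter_upwards [Measure.ae_ne volume p, Measure.ae_ne volume (p + 1)] with x hx hx'
  constructor
  · rintro ⟨h1, h2⟩
    have hx2 : x ∈ Set.Ico p (p + 1) := ⟨h2.1.le, lt_of_le_of_ne h2.2 hx'⟩
    have h3 : ((AddCircle.equivIco 1 p (x : UnitAddCircle) : Set.Ico p (p + 1)) : ℝ) < q := h1
    rw [AddCircle.equivIco_coe_of_mem hx2] at h3
    exact ⟨h2.1.le, h3⟩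
  · intro h
    have hx2 : x ∈ Set.Ico p (p + 1) := ⟨h.1, h.2.trans_le hq⟩
    refine ⟨?_, lt_of_le_of_ne h.1 (Ne.symm hx), hx2.2.le⟩
    show ((AddCircle.equivIco 1 p (x : UnitAddCircle) : Set.Ico p (p + 1)) : ℝ) < q
    rw [AddCircle.equivIco_coe_of_mem hx2]
    exact h.2

lemma norm_coe_le_abs (r : ℝ) : ‖(r : UnitAddCircle)‖ ≤ |r| := by
  rw [UnitAddCircle.norm_eq]
  simpa using round_le r 0

variable {d : ℕ} {N : ℕ}

lemma coe_mesh : (mesh N : ℝ) = 1 / N := by simp [mesh]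

/-- The lower corner of a cube. -/
noncomputable def corner (z : Fin d → ZMod N) : Torus d :=
  fun i => (((mesh N : ℝ) * (z i).val : ℝ) : UnitAddCircle)

lemma flatDist_corner_le {z : Fin d → ZMod N} {u : Torus d} (hu : u ∈ cube N z) :
    flatDist u (corner z) ≤ Real.sqrt d * mesh N := by
  obtain ⟨s, hs, rfl⟩ := hu
  refine flatDist_le_of_forall_le (NNReal.coe_nonneg _) fun i => ?_
  rw [corner, ← AddCircle.coe_sub]
  refine (norm_coe_le_abs _).trans ?_
  rw [← mul_sub, add_sub_cancel_left, abs_mul, abs_of_nonneg (NNReal.coe_nonneg _),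
    abs_of_nonneg (hs i).1]
  exact mul_le_of_le_one_right (NNReal.coe_nonneg _) (hs i).2.le

variable [NeZero N]

lemma mesh_pos : 0 < mesh N := by
  have := NeZero.pos N
  unfold mesh
  positivity

lemma mesh_mul_cast : (mesh N : ℝ) * N = 1 := by
  rw [coe_mesh]
  have : (N : ℝ) ≠ 0 := Nat.cast_ne_zero.2 (NeZero.ne N)
  field_simp

lemma cube_eq_pi (z : Fin d → ZMod N) : cube N z = Set.univ.pi fun i =>
    {u : UnitAddCircle | ∃ r ∈ Set.Ico ((mesh N : ℝ) * (z i).val) ((mesh N : ℝ) * ((z i).val + 1)),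
      u = (r : UnitAddCircle)} := by
  have hm : (0 : ℝ) < mesh N := mesh_pos
  ext u
  simp only [Set.mem_pi, Set.mem_univ, true_implies]
  constructor
  · rintro ⟨s, hs, rfl⟩ i
    refine ⟨_, ⟨?_, ?_⟩, rfl⟩
    · exact mul_le_mul_of_nonneg_left (by linarith [(hs i).1]) hm.le
    · exact mul_lt_mul_of_pos_left (by linarith [(hs i).2]) hm
  · intro h
    choose r hr hu using h
    refine ⟨fun i => r i / mesh N - (z i).val, fun i => ?_, funext fun i => ?_⟩
    · have h1 := (le_div_iff₀' hm).2 (hr i).1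
      have h2 := (div_lt_iff₀' hm).2 (hr i).2
      exact ⟨by linarith, by linarith⟩
    · rw [hu i]
      congr 1
      field_simp
      ring

lemma arc_bound (z : ZMod N) :
    (mesh N : ℝ) * (z.val + 1) ≤ (mesh N : ℝ) * z.val + 1 := by
  have h1 : (mesh N : ℝ) ≤ 1 := by
    rw [coe_mesh]
    exact div_le_one_of_le₀ (by exact_mod_cast NeZero.pos N) (by positivity)
  linarith

lemma volume_cube (z : Fin d → ZMod N) :
    (volume : Measure (Torus d)) (cube N z) = ((mesh N ^ d : ℝ≥0) : ℝ≥0∞) := by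
  rw [cube_eq_pi]
  show Measure.pi _ _ = _
  rw [Measure.pi_pi]
  simp only [(volume_arc (arc_bound (z _))).2]
  have : ∀ i, (mesh N : ℝ) * ((z i).val + 1) - mesh N * (z i).val = mesh N := fun i => by ring
  rw [Finset.prod_congr rfl fun i _ => congrArg ENNReal.ofReal (this i)]
  simp

/-- Reduction modulo `N` changes a coordinate by a multiple of `N`, and `mesh N * N = 1`. Corners of
adjacent cells can thus be compared in `ℤ^d`, even across the periodic boundary. -/
lemma corner_wrap {V : Type*} (x : Vertex d V) (i : Fin d) :
    corner (wrap N 0 x).1 i = (((mesh N : ℝ) * x.1 i : ℝ) : UnitAddCircle) := by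
  rw [corner, ← sub_eq_zero, ← AddCircle.coe_sub, AddCircle.coe_eq_zero_iff]
  have h : (((((wrap N 0 x).1 i).val : ℤ) - x.1 i : ℤ) : ZMod N) = 0 := by
    simp [wrap]
  obtain ⟨k, hk⟩ := (ZMod.intCast_zmod_eq_zero_iff_dvd _ N).1 h
  refine ⟨k, ?_⟩
  have hk' : ((((wrap N 0 x).1 i).val : ℝ) - x.1 i) = N * k := by exact_mod_cast hk
  rw [← mul_sub, hk', ← mul_assoc, mesh_mul_cast]
  simp

/-- The mean value of a function over a cube. -/
noncomputable def cellAvg (ψ : C(Torus d, ℝ)) (z : Fin d → ZMod N) : ℝ :=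
  ((mesh N : ℝ) ^ d)⁻¹ * ∫ u in cube N z, ψ u

lemma abs_cellAvg_sub_le {ψ : C(Torus d, ℝ)} (hψ : ψ ∈ krTests d) (z : Fin d → ZMod N) :
    |cellAvg ψ z - ψ (corner z)| ≤ Real.sqrt d * mesh N := by
  have hm : (0 : ℝ) < (mesh N : ℝ) ^ d := pow_pos (mesh_pos (N := N)) d
  have hvol : (volume : Measure (Torus d)).real (cube N z) = (mesh N : ℝ) ^ d := by
    rw [measureReal_def, volume_cube]; simp
  have hint : IntegrableOn ψ (cube N z) :=
    (integrable_continuousMap ψ (lebesgue d)).integrableOn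
  have h1 : ∫ u in cube N z, (ψ u - ψ (corner z)) =
      (∫ u in cube N z, ψ u) - (mesh N : ℝ) ^ d * ψ (corner z) := by
    rw [integral_sub hint (integrable_const _), setIntegral_const, hvol, smul_eq_mul]
  have h2 : cellAvg ψ z - ψ (corner z) =
      ((mesh N : ℝ) ^ d)⁻¹ * ∫ u in cube N z, (ψ u - ψ (corner z)) := by
    rw [h1, cellAvg]
    field_simp
  have h3 : ‖∫ u in cube N z, (ψ u - ψ (corner z))‖ ≤ Real.sqrt d * mesh N * (mesh N : ℝ) ^ d := by
    rw [← hvol]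
    refine norm_setIntegral_le_of_norm_le_const ?_ fun u hu => ?_
    · rw [volume_cube]; exact ENNReal.coe_lt_top
    · exact (hψ.2 _ _).trans (flatDist_corner_le hu)
  rw [h2, abs_mul, abs_inv, abs_of_pos hm, inv_mul_le_iff₀ hm, mul_comm]
  exact h3

variable {V : Type*} [Fintype V]

lemma integral_embed (ψ : C(Torus d, ℝ)) (m : TVertex d V N → ℝ≥0) :
    ∫ u, ψ u ∂(embed N m : Measure (Torus d)) = ∑ x, (m x : ℝ) * cellAvg ψ x.1 := by
  rw [embed, FiniteMeasure.toMeasure_sum, integral_finsetSum_measure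
    fun x _ => integrable_continuousMap ψ _]
  refine Finset.sum_congr rfl fun x _ => ?_
  rw [FiniteMeasure.toMeasure_smul, FiniteMeasure.restrict_measure_eq,
    integral_smul_nnreal_measure, NNReal.smul_def, smul_eq_mul, cellAvg]
  push_cast
  rw [show ((lebesgue d : FiniteMeasure (Torus d)) : Measure (Torus d)) = volume from rfl]
  ring

lemma cellAvg_one (z : Fin d → ZMod N) : cellAvg (1 : C(Torus d, ℝ)) z = 1 := by
  have hm : (0 : ℝ) < (mesh N : ℝ) ^ d := pow_pos (mesh_pos (N := N)) d
  have hvol : (volume : Measure (Torus d)).real (cube N z) = (mesh N : ℝ) ^ d := by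
    rw [measureReal_def, volume_cube]; simp
  simp [cellAvg, hvol, hm.ne']

lemma mass_embed (m : TVertex d V N → ℝ≥0) : (embed N m).mass = ∑ x, m x := by
  have h := integral_embed (1 : C(Torus d, ℝ)) m
  simp only [cellAvg_one, mul_one, ContinuousMap.one_apply, integral_const, smul_eq_mul] at h
  rw [← NNReal.coe_inj]
  push_cast
  exact h

lemma continuous_embed : Continuous (embed (d := d) (V := V) N) := by
  rw [FiniteMeasure.continuous_iff_forall_continuousMap_continuous_integral]
  intro ψ
  simp only [integral_embed]
  fun_prop

end Cubes

/-! ### Discrete fluxes -/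

section Flux

variable {α : Type*} {r : α → α → Prop}

open Classical in
/-- The extension of a discrete vector field by zero to all pairs of vertices. -/
noncomputable def fluxFn (J : AntisymField r) (x y : α) : ℝ :=
  if h : r x y then J.1 ⟨(x, y), h⟩ else 0

lemma fluxFn_of_adj (J : AntisymField r) {x y : α} (h : r x y) : fluxFn J x y = J.1 ⟨(x, y), h⟩ :=
  dif_pos h

lemma fluxFn_of_not_adj (J : AntisymField r) {x y : α} (h : ¬ r x y) : fluxFn J x y = 0 :=
  dif_neg h

lemma fluxFn_swap (hr : ∀ x y, r x y → r y x) (J : AntisymField r) (x y : α) :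
    fluxFn J x y = -fluxFn J y x := by
  by_cases h : r x y
  · rw [fluxFn_of_adj J h, fluxFn_of_adj J (hr _ _ h)]
    exact J.2 x y h _
  · rw [fluxFn_of_not_adj J h, fluxFn_of_not_adj J fun h' => h (hr _ _ h'), neg_zero]

variable [Fintype α]

/-- The total flux `∑ |J(x,y)|`. -/
noncomputable def absFlux (J : AntisymField r) : ℝ := ∑ x, ∑ y, |fluxFn J x y|

lemma absFlux_nonneg (J : AntisymField r) : 0 ≤ absFlux J :=
  Finset.sum_nonneg fun _ _ => Finset.sum_nonneg fun _ _ => abs_nonneg _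

lemma divergence_eq_sum (J : AntisymField r) (x : α) : divergence J x = ∑ y, fluxFn J x y := by
  classical
  rw [divergence, finsum_eq_sum_of_fintype]
  have h1 : ∀ y : {y // r x y}, J.1 ⟨(x, y.1), y.2⟩ = fluxFn J x y.1 := fun y =>
    (fluxFn_of_adj J y.2).symm
  simp only [h1]
  rw [← Finset.sum_subtype (Finset.univ.filter fun y => r x y) (by simp) (fluxFn J x)]
  refine Finset.sum_filter_of_ne fun y _ hy => ?_
  by_contra hcon
  exact hy (fluxFn_of_not_adj J hcon)

/-- Summation by parts. -/
lemma abs_sum_mul_divergence_le (hr : ∀ x y, r x y → r y x) (J : AntisymField r) (A : α → ℝ)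
    {c : ℝ} (hA : ∀ x y, r x y → |A x - A y| ≤ c) :
    |∑ x, A x * divergence J x| ≤ c / 2 * absFlux J := by
  have h1 : ∑ x, A x * divergence J x = ∑ x, ∑ y, A x * fluxFn J x y := by
    simp only [divergence_eq_sum, Finset.mul_sum]
  -- Antisymmetry under exchanging `x` and `y`. Averaging the two forms produces `A x - A y` and the
  -- factor `1 / 2`, as `absFlux` counts both orientations of an edge.
  have h2 : ∑ x, ∑ y, A x * fluxFn J x y = -∑ x, ∑ y, A y * fluxFn J x y := by
    rw [Finset.sum_comm, ← Finset.sum_neg_distrib]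
    refine Finset.sum_congr rfl fun y _ => ?_
    rw [← Finset.sum_neg_distrib]
    refine Finset.sum_congr rfl fun x _ => ?_
    rw [fluxFn_swap hr J]
    ring
  have h3 : 2 * ∑ x, A x * divergence J x = ∑ x, ∑ y, (A x - A y) * fluxFn J x y := by
    simp only [sub_mul, Finset.sum_sub_distrib]
    linarith
  have h4 : |2 * ∑ x, A x * divergence J x| ≤ c * absFlux J := by
    rw [h3, absFlux, Finset.mul_sum]
    refine (Finset.abs_sum_le_sum_abs _ _).trans (Finset.sum_le_sum fun x _ => ?_)
    rw [Finset.mul_sum]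
    refine (Finset.abs_sum_le_sum_abs _ _).trans (Finset.sum_le_sum fun y _ => ?_)
    rw [abs_mul]
    by_cases h : r x y
    · exact mul_le_mul_of_nonneg_right (hA x y h) (abs_nonneg _)
    · simp [fluxFn_of_not_adj J h]
  rw [abs_mul, abs_two] at h4
  linarith

lemma sum_divergence_eq_zero (hr : ∀ x y, r x y → r y x) (J : AntisymField r) :
    ∑ x, divergence J x = 0 := by
  have := abs_sum_mul_divergence_le hr J (fun _ => 1) (c := 0) (by simp)
  simpa using this

end Flux

/-! ### The rescaled graph -/

section Graph

variable {d : ℕ} {V : Type*}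

lemma tadj_symm (G : PeriodicGraph d V) (N : ℕ) (p q : TVertex d V N) (h : G.TAdj N p q) :
    G.TAdj N q p := by
  obtain ⟨x, y, hxy, hx, hy⟩ := h
  exact ⟨y, x, G.symm _ _ hxy, hy, hx⟩

lemma wrap_shift {N : ℕ} (w : Fin d → ℤ) (x : Vertex d V) :
    wrap N 0 (shift w x) = wrap N (fun i => (w i : ZMod N)) x := by
  refine Prod.ext (funext fun i => ?_) rfl
  simp [wrap, shift]

lemma shift_neg_shift (w : Fin d → ℤ) (x : Vertex d V) : shift w (shift (-w) x) = x := by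
  refine Prod.ext ?_ rfl
  simp [shift]

/-- By periodicity every edge is a translate of one of the finitely many edges that start in the
unit cell. -/
lemma exists_edge_bound [Finite V] (G : PeriodicGraph d V) :
    ∃ L : ℝ, 0 ≤ L ∧ ∀ x y, G.Adj x y → ∀ i, |(x.1 i : ℝ) - y.1 i| ≤ L := by
  have := finite_unitEdge G
  obtain ⟨L, hL⟩ := (Set.finite_range fun e : G.UnitEdge => ‖e.1.1.2.1‖).bddAbove
  refine ⟨max L 0, le_max_right _ _, fun x y hxy i => ?_⟩
  have hadj : G.Adj (shift (-x.1) x) (shift (-x.1) y) := (G.periodic _ _ _).2 hxy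
  have h1 : ‖(shift (-x.1) y).1‖ ≤ L := hL ⟨⟨⟨(_, _), hadj⟩, by simp⟩, rfl⟩
  have h2 := (norm_le_pi_norm (shift (-x.1) y).1 i).trans h1
  refine le_trans ?_ (le_max_left _ _)
  rw [abs_sub_comm]
  have h3 : (shift (-x.1) y).1 i = y.1 i - x.1 i := by simp [shift]; ring
  rw [h3, Int.norm_eq_abs] at h2
  exact_mod_cast h2

/-- Every edge of the rescaled graph is the image of an edge starting in the unit cell. -/
lemma exists_unitEdge (G : PeriodicGraph d V) {N : ℕ} {p q : TVertex d V N} (h : G.TAdj N p q) :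
    ∃ (z : Fin d → ZMod N) (e : G.UnitEdge), wrap N z e.1.1.1 = p ∧ wrap N z e.1.1.2 = q := by
  obtain ⟨x, y, hxy, rfl, rfl⟩ := h
  have hadj : G.Adj (shift (-x.1) x) (shift (-x.1) y) := (G.periodic _ _ _).2 hxy
  refine ⟨fun i => (x.1 i : ZMod N), ⟨⟨(_, _), hadj⟩, by simp⟩, ?_, ?_⟩ <;>
  · show wrap N _ (shift _ _) = _
    rw [← wrap_shift, shift_neg_shift]

lemma localMass_nonneg (R : ℝ) (m : Vertex d V → ℝ≥0) : 0 ≤ localMass R m :=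
  finsum_nonneg fun _ => NNReal.coe_nonneg _

lemma unitFlux_nonneg (G : PeriodicGraph d V) (J : AntisymField G.Adj) : 0 ≤ G.unitFlux J :=
  finsum_nonneg fun _ => abs_nonneg _

/-- Superlinear growth gives affine lower bounds with arbitrarily large slope. -/
lemma exists_affine_bound {G : PeriodicGraph d V} {R₁ : ℝ} {F : Cost G}
    (hF : IsSuperlinear G R₁ F) (K : ℝ≥0) : ∃ C : ℝ, 0 ≤ C ∧ ∀ m J,
      ((K * G.unitFlux J - C * (1 + localMass (max G.maxEdgeLength R₁) m) : ℝ) : EReal) ≤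
        F m J := by
  obtain ⟨θ, C, hθ, hF⟩ := hF
  obtain ⟨T, hT⟩ := eventually_atTop.1 (hθ.eventually_ge_atTop K)
  -- Beyond `T` superlinearity gives `θ t ≥ K t`; below `T` the left side is nonpositive.
  have hθ' : ∀ t : ℝ≥0, (K : ℝ) * t - K * T ≤ θ t := by
    intro t
    rcases le_total T t with h | h
    · have h1 : K * t ≤ θ t := by
        rcases eq_or_ne t 0 with rfl | h0
        · simp
        · exact (le_div_iff₀ (pos_iff_ne_zero.2 h0)).1 (hT t h)
      have h2 : (K : ℝ) * t ≤ θ t := by exact_mod_cast h1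
      have h3 : (0 : ℝ) ≤ K * T := by positivity
      linarith
    · have h1 : (K : ℝ) * t ≤ K * T := by gcongr
      linarith [NNReal.coe_nonneg (θ t)]
  refine ⟨K * T + |C|, by positivity, fun m J => le_trans (EReal.coe_le_coe_iff.2 ?_) (hF m J)⟩
  set M := localMass (max G.maxEdgeLength R₁) m
  have hM : 0 ≤ M := localMass_nonneg _ _
  have hM1 : 0 < M + 1 := by linarith
  have hJ := unitFlux_nonneg G J
  have h1 := hθ' (Real.toNNReal (G.unitFlux J / (M + 1)))
  rw [Real.coe_toNNReal _ (by positivity)] at h1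
  have h2 := mul_le_mul_of_nonneg_left h1 hM1.le
  have h3 : (M + 1) * ((K : ℝ) * (G.unitFlux J / (M + 1)) - K * T) =
      K * G.unitFlux J - (M + 1) * (K * T) := by field_simp
  have h4 := mul_le_mul_of_nonneg_right (le_abs_self C) hM1.le
  rw [h3] at h2
  linarith

variable {N : ℕ}

lemma coe_blowUpFlux (G : PeriodicGraph d V) (z : Fin d → ZMod N) (J : AntisymField (G.TAdj N))
    (e : Edge G.Adj) : (blowUpFlux G N z J).1 e =
      fluxFn J (wrap N z e.1.1) (wrap N z e.1.2) / (mesh N : ℝ) ^ ((d : ℤ) - 1) := by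
  rw [fluxFn_of_adj J (G.tadj_wrap N z e.2)]
  rfl

variable [NeZero N]

/-- Each average is within `√d ε` of the value at the corner of its cell, and the two corners are at
distance at most `√d L ε`. -/
lemma abs_cellAvg_sub_cellAvg_le (G : PeriodicGraph d V) {L : ℝ} (hL0 : 0 ≤ L)
    (hL : ∀ x y, G.Adj x y → ∀ i, |(x.1 i : ℝ) - y.1 i| ≤ L) {ψ : C(Torus d, ℝ)}
    (hψ : ψ ∈ krTests d) (p q : TVertex d V N) (h : G.TAdj N p q) :
    |cellAvg ψ p.1 - cellAvg ψ q.1| ≤ Real.sqrt d * (L + 2) * mesh N := by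
  obtain ⟨x, y, hxy, rfl, rfl⟩ := h
  have h1 := abs_cellAvg_sub_le hψ (wrap N 0 x).1
  have h2 := abs_cellAvg_sub_le hψ (wrap N 0 y).1
  have hm : (0 : ℝ) ≤ mesh N := NNReal.coe_nonneg _
  have h3 : |ψ (corner (wrap N 0 x).1) - ψ (corner (wrap N 0 y).1)| ≤
      Real.sqrt d * (mesh N * L) := by
    refine (hψ.2 _ _).trans (flatDist_le_of_forall_le (by positivity) fun i => ?_)
    rw [corner_wrap, corner_wrap, ← AddCircle.coe_sub, ← mul_sub]
    refine (norm_coe_le_abs _).trans ?_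
    rw [abs_mul, abs_of_nonneg hm]
    exact mul_le_mul_of_nonneg_left (hL x y hxy i) hm
  rw [abs_le] at h1 h2 h3 ⊢
  constructor <;> nlinarith

variable [Fintype V]

/-- The scalings combine to `ε^d / ε^(d-1) = ε`. Every edge of the rescaled graph arises from a cell
and a unit edge; surjectivity suffices for an inequality, since all terms are nonnegative. -/
lemma mesh_mul_absFlux_le (G : PeriodicGraph d V) (J : AntisymField (G.TAdj N)) :
    (mesh N : ℝ) * absFlux J ≤
      ∑ z : Fin d → ZMod N, (mesh N : ℝ) ^ d * G.unitFlux (blowUpFlux G N z J) := by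
  classical
  have hm : (0 : ℝ) < mesh N := mesh_pos
  have := finite_unitEdge G
  have := Fintype.ofFinite G.UnitEdge
  have h1 : ∀ z, (mesh N : ℝ) ^ d * G.unitFlux (blowUpFlux G N z J) = mesh N *
      ∑ e : G.UnitEdge, |fluxFn J (wrap N z e.1.1.1) (wrap N z e.1.1.2)| := by
    intro z
    rw [PeriodicGraph.unitFlux, finsum_eq_sum_of_fintype, Finset.mul_sum, Finset.mul_sum]
    refine Finset.sum_congr rfl fun e _ => ?_
    rw [coe_blowUpFlux, abs_div, abs_of_pos (zpow_pos hm _), zpow_sub₀ hm.ne', zpow_natCast,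
      zpow_one]
    field_simp
  simp only [h1]
  rw [← Finset.mul_sum]
  refine mul_le_mul_of_nonneg_left ?_ hm.le
  let f : TVertex d V N × TVertex d V N → ℝ := fun p => |fluxFn J p.1 p.2|
  let w : (Fin d → ZMod N) × G.UnitEdge → TVertex d V N × TVertex d V N := fun ze =>
    (wrap N ze.1 ze.2.1.1.1, wrap N ze.1 ze.2.1.1.2)
  have hL : absFlux J = ∑ p ∈ Finset.univ.image w, f p := by
    rw [absFlux, ← Finset.sum_product', Finset.univ_product_univ]
    symm
    refine Finset.sum_subset (Finset.subset_univ _) fun p _ hp => ?_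
    have : ¬ G.TAdj N p.1 p.2 := fun h => hp (by
      obtain ⟨z, e, h1, h2⟩ := exists_unitEdge G h
      exact Finset.mem_image.2 ⟨(z, e), Finset.mem_univ _, Prod.ext h1 h2⟩)
    simp [f, fluxFn_of_not_adj J this]
  have hR : ∑ z : Fin d → ZMod N, ∑ e : G.UnitEdge,
      |fluxFn J (wrap N z e.1.1.1) (wrap N z e.1.1.2)| = ∑ ze, f (w ze) := by
    rw [← Finset.sum_product', Finset.univ_product_univ]
  rw [hL, hR]
  exact Finset.sum_image_le_of_nonneg (fun _ _ => abs_nonneg _)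

/-- For a fixed `x` in the ball, distinct cells `z` reach distinct vertices, so each `x` contributes
at most the total mass. -/
lemma sum_localMass_le (R : ℝ) (m : TVertex d V N → ℝ≥0) :
    ∑ z : Fin d → ZMod N, (mesh N : ℝ) ^ d * localMass R (blowUpMass N z m) ≤
      Nat.card {x : Vertex d V // ‖x.1‖ ≤ R} * ∑ x, (m x : ℝ) := by
  classical
  have hm : (0 : ℝ) < mesh N := mesh_pos
  have := finite_ball (d := d) (V := V) R
  have := Fintype.ofFinite {x : Vertex d V // ‖x.1‖ ≤ R}
  have h1 : ∀ z, (mesh N : ℝ) ^ d * localMass R (blowUpMass N z m) =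
      ∑ x : {x : Vertex d V // ‖x.1‖ ≤ R}, (m (wrap N z x.1) : ℝ) := by
    intro z
    rw [localMass, finsum_eq_sum_of_fintype, Finset.mul_sum]
    refine Finset.sum_congr rfl fun x _ => ?_
    simp only [blowUpMass, NNReal.coe_div, NNReal.coe_pow]
    field_simp
  simp only [h1]
  rw [Finset.sum_comm, Nat.card_eq_fintype_card, ← nsmul_eq_mul, ← Finset.card_univ]
  refine Finset.sum_le_card_nsmul _ _ _ fun x _ => ?_
  have hinj : Function.Injective fun z : Fin d → ZMod N => wrap N z x.1 := by
    intro z z' h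
    funext i
    have := congrFun (congrArg Prod.fst h) i
    simpa [wrap] using this
  calc ∑ z : Fin d → ZMod N, (m (wrap N z x.1) : ℝ)
      = ∑ y ∈ Finset.univ.image fun z : Fin d → ZMod N => wrap N z x.1, (m y : ℝ) :=
        (Finset.sum_image (f := fun y => (m y : ℝ)) fun _ _ _ _ h => hinj h).symm
    _ ≤ ∑ y, (m y : ℝ) := Finset.sum_le_sum_of_subset_of_nonneg (Finset.subset_univ _)
        fun _ _ _ => NNReal.coe_nonneg _

lemma sum_mesh_pow : ∑ _z : Fin d → ZMod N, (mesh N : ℝ) ^ d = 1 := by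
  rw [Finset.sum_const, Finset.card_univ, Fintype.card_pi, Finset.prod_const, Finset.card_univ,
    Fintype.card_fin, ZMod.card, nsmul_eq_mul, Nat.cast_pow, ← mul_pow, mul_comm, mesh_mul_cast,
    one_pow]

lemma ereal_coe_sum {ι : Type*} (s : Finset ι) (f : ι → ℝ) :
    ((∑ i ∈ s, f i : ℝ) : EReal) = ∑ i ∈ s, (f i : EReal) :=
  map_sum (⟨⟨Real.toEReal, EReal.coe_zero⟩, EReal.coe_add⟩ : ℝ →+ EReal) f s

lemma le_energy_of_le {G : PeriodicGraph d V} {R₁ : ℝ} {F : Cost G} {K : ℝ≥0} {C : ℝ}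
    (hC : 0 ≤ C) (hF : ∀ m J,
      ((K * G.unitFlux J - C * (1 + localMass (max G.maxEdgeLength R₁) m) : ℝ) : EReal) ≤ F m J)
    (m : TVertex d V N → ℝ≥0) (J : AntisymField (G.TAdj N)) :
    ((K * (mesh N * absFlux J) - C * (1 + Nat.card
      {x : Vertex d V // ‖x.1‖ ≤ max G.maxEdgeLength R₁} * ∑ x, (m x : ℝ)) : ℝ) : EReal) ≤
      energy G F N m J := by
  set R := max G.maxEdgeLength R₁
  have h1 : ((∑ z : Fin d → ZMod N, (mesh N : ℝ) ^ d * (K * G.unitFlux (blowUpFlux G N z J) -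
      C * (1 + localMass R (blowUpMass N z m))) : ℝ) : EReal) ≤ energy G F N m J := by
    rw [energy, ereal_coe_sum]
    refine Finset.sum_le_sum fun z _ => ?_
    rw [EReal.coe_mul]
    exact mul_le_mul_of_nonneg_left (hF _ _) (EReal.coe_nonneg.2 (by positivity))
  refine le_trans (EReal.coe_le_coe_iff.2 ?_) h1
  have h2 := mul_le_mul_of_nonneg_left (mesh_mul_absFlux_le G J) (NNReal.coe_nonneg K)
  have h3 := mul_le_mul_of_nonneg_left (sum_localMass_le R m) hC
  have h4 : ∑ z : Fin d → ZMod N, (mesh N : ℝ) ^ d * (K * G.unitFlux (blowUpFlux G N z J) -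
      C * (1 + localMass R (blowUpMass N z m))) =
      K * ∑ z : Fin d → ZMod N, (mesh N : ℝ) ^ d * G.unitFlux (blowUpFlux G N z J) -
      C * (∑ _z : Fin d → ZMod N, (mesh N : ℝ) ^ d +
        ∑ z : Fin d → ZMod N, (mesh N : ℝ) ^ d * localMass R (blowUpMass N z m)) := by
    rw [← Finset.sum_add_distrib, Finset.mul_sum, Finset.mul_sum, ← Finset.sum_sub_distrib]
    refine Finset.sum_congr rfl fun z _ => ?_
    ring
  rw [h4, sum_mesh_pow]
  linarith

end Graph

/-! ### Curves of finite action -/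

section Action

variable {d : ℕ} {V : Type*} {a b : ℝ} {N : ℕ} {G : PeriodicGraph d V}

lemma measurable_fluxFn {J : Time a b → AntisymField (G.TAdj N)}
    (hJ : ∀ e, Measurable fun t => (J t).1 e) (x y : TVertex d V N) :
    Measurable fun t => fluxFn (J t) x y := by
  by_cases h : G.TAdj N x y
  · simp only [fluxFn_of_adj _ h]
    exact hJ _
  · simp only [fluxFn_of_not_adj _ h]
    exact measurable_const

variable [NeZero N] [Fintype V]

lemma measurable_absFlux {J : Time a b → AntisymField (G.TAdj N)}
    (hJ : ∀ e, Measurable fun t => (J t).1 e) : Measurable fun t => absFlux (J t) :=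
  Finset.measurable_fun_sum _ fun x _ => Finset.measurable_fun_sum _ fun y _ =>
    continuous_abs.measurable.comp (measurable_fluxFn hJ x y)

lemma ofReal_affine {C : ℝ} (hC : 0 ≤ C) (k : ℕ) (m : TVertex d V N → ℝ≥0) :
    ENNReal.ofReal (C * (1 + k * ∑ x, (m x : ℝ))) =
      ENNReal.ofReal C * (1 + k * ∑ x, (m x : ℝ≥0∞)) := by
  have h : (1 + k * ∑ x, (m x : ℝ)) = ((1 + k * ∑ x, m x : ℝ≥0) : ℝ) := by push_cast; rfl
  rw [ENNReal.ofReal_mul hC, h, ENNReal.ofReal_coe_nnreal]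
  push_cast
  rfl

/-- Finiteness of the negative part is what allows moving it across the inequality in the extended
reals. -/
lemma lintegral_positive_part_le {e : Time a b → EReal} {A : ℝ} {q : ℝ≥0∞} (hq : q ≠ ⊤)
    (he : eintegral (timeVol a b) e < A) (hneg : ∫⁻ t, (-e t).toENNReal ∂(timeVol a b) ≤ q) :
    ∫⁻ t, (e t).toENNReal ∂(timeVol a b) ≤ ENNReal.ofReal A + q := by
  rw [eintegral] at he
  generalize ∫⁻ t, (e t).toENNReal ∂(timeVol a b) = P at he ⊢
  generalize ∫⁻ t, (-e t).toENNReal ∂(timeVol a b) = Q at he hneg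
  have hQ : Q ≠ ⊤ := ne_top_of_le_ne_top hq hneg
  lift Q to ℝ≥0 using hQ
  refine le_trans ?_ (add_le_add_right hneg _)
  rw [← EReal.coe_ennreal_le_coe_ennreal_iff, EReal.coe_ennreal_add, EReal.coe_ennreal_ofReal]
  have h1 : (P : EReal) < A + ((Q : ℝ≥0∞) : EReal) :=
    (EReal.sub_lt_iff (by simp) (by simp)).1 he
  refine h1.le.trans (add_le_add_left ?_ _)
  exact EReal.coe_le_coe_iff.2 (le_max_left _ _)

/-- The energy is integrated over the whole interval and only the mass term sees `S`: this is the
source of equi-integrability. The integral splits because the mass term is measurable; nothing is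
needed of `e`. -/
lemma setLIntegral_flux_le {e : Time a b → EReal} {m : Time a b → TVertex d V N → ℝ≥0}
    {f : Time a b → ℝ} {C : ℝ} (hC : 0 ≤ C) {k : ℕ} (hm : Continuous m)
    (h : ∀ t, ((f t - C * (1 + k * ∑ x, (m t x : ℝ)) : ℝ) : EReal) ≤ e t) (S : Set (Time a b)) :
    ∫⁻ t in S, ENNReal.ofReal (f t) ∂(timeVol a b) ≤ ∫⁻ t, (e t).toENNReal ∂(timeVol a b) +
      ENNReal.ofReal C * ∫⁻ t in S, (1 + k * ∑ x, (m t x : ℝ≥0∞)) ∂(timeVol a b) := by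
  have hpt : ∀ t, ENNReal.ofReal (f t) ≤ (e t).toENNReal +
      ENNReal.ofReal C * (1 + k * ∑ x, (m t x : ℝ≥0∞)) := by
    intro t
    rw [← ofReal_affine hC]
    set c := C * (1 + k * ∑ x, (m t x : ℝ))
    have h1 : (f t : EReal) ≤ e t + (c : EReal) := by
      have h2 := add_le_add_left (h t) (c : EReal)
      rwa [← EReal.coe_add, sub_add_cancel] at h2
    refine le_trans ?_ ((EReal.toENNReal_le_toENNReal h1).trans EReal.toENNReal_add_le) |>.trans ?_
    · exact (EReal.toENNReal_of_ne_top (EReal.coe_ne_top _)).ge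
    · rw [EReal.toENNReal_of_ne_top (EReal.coe_ne_top c), EReal.toReal_coe]
  have hmeas : Measurable fun t => ENNReal.ofReal C * (1 + k * ∑ x, (m t x : ℝ≥0∞)) := by
    have : ∀ x, Measurable fun t => (m t x : ℝ≥0∞) := fun x =>
      ((continuous_apply x).comp hm).measurable.coe_nnreal_ennreal
    fun_prop
  calc ∫⁻ t in S, ENNReal.ofReal (f t) ∂(timeVol a b)
      ≤ ∫⁻ t in S, ((e t).toENNReal + ENNReal.ofReal C * (1 + k * ∑ x, (m t x : ℝ≥0∞)))
          ∂(timeVol a b) := lintegral_mono hpt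
    _ = ∫⁻ t in S, (e t).toENNReal ∂(timeVol a b) + ENNReal.ofReal C *
          ∫⁻ t in S, (1 + k * ∑ x, (m t x : ℝ≥0∞)) ∂(timeVol a b) := by
        rw [lintegral_add_right _ hmeas, lintegral_const_mul' _ _ ENNReal.ofReal_ne_top]
    _ ≤ _ := by
        gcongr
        exact Measure.restrict_le_self

lemma lintegral_negative_part_le {e : Time a b → EReal} {m : Time a b → TVertex d V N → ℝ≥0}
    {C : ℝ} (hC : 0 ≤ C) {k : ℕ}
    (h : ∀ t, ((-(C * (1 + k * ∑ x, (m t x : ℝ))) : ℝ) : EReal) ≤ e t) :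
    ∫⁻ t, (-e t).toENNReal ∂(timeVol a b) ≤
      ENNReal.ofReal C * (ENNReal.ofReal (b - a) + k * totalMass m) := by
  have hpt : ∀ t, (-e t).toENNReal ≤ ENNReal.ofReal C * (1 + k * ∑ x, (m t x : ℝ≥0∞)) := by
    intro t
    rw [← ofReal_affine hC]
    have h1 : -e t ≤ ((C * (1 + k * ∑ x, (m t x : ℝ)) : ℝ) : EReal) := by
      rw [EReal.neg_le, ← EReal.coe_neg]
      exact h t
    refine (EReal.toENNReal_le_toENNReal h1).trans ?_
    rw [EReal.toENNReal_of_ne_top (EReal.coe_ne_top _), EReal.toReal_coe]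
  refine (lintegral_mono hpt).trans ?_
  rw [lintegral_const_mul' _ _ ENNReal.ofReal_ne_top, lintegral_add_left measurable_const,
    lintegral_const_mul' _ _ (ENNReal.natCast_ne_top _), lintegral_const, timeVol_univ, one_mul]
  rfl

lemma integrable_absFlux {J : Time a b → AntisymField (G.TAdj N)}
    (hJ : ∀ e, Measurable fun t => (J t).1 e)
    (hfin : ∫⁻ t, ENNReal.ofReal (mesh N * absFlux (J t)) ∂(timeVol a b) < ⊤) :
    Integrable (fun t => absFlux (J t)) (timeVol a b) := by
  have hm : (0 : ℝ) < mesh N := mesh_pos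
  have : Integrable (fun t => (mesh N : ℝ) * absFlux (J t)) (timeVol a b) := by
    refine ⟨((measurable_absFlux hJ).const_mul _).aestronglyMeasurable, ?_⟩
    rwa [hasFiniteIntegral_iff_ofReal
      (Eventually.of_forall fun t => mul_nonneg hm.le (absFlux_nonneg _))]
  convert this.const_mul (mesh N : ℝ)⁻¹ using 2 with t
  field_simp

/-- The du Bois-Reymond lemma at each vertex, every divergence being dominated by the integrable
`absFlux`. Taking `A = 1` yields conservation of mass, and cell averages yield the metric speed
bound. -/
lemma DiscreteCE.sum_sub_eq {m : Time a b → TVertex d V N → ℝ≥0}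
    {J : Time a b → AntisymField (G.TAdj N)} (h : DiscreteCE G a b N m J)
    (hJ : Integrable (fun t => absFlux (J t)) (timeVol a b)) (A : TVertex d V N → ℝ)
    {s t : Time a b} (hst : s ≤ t) :
    ∑ x, (m t x : ℝ) * A x - ∑ x, (m s x : ℝ) * A x =
      -∫ r in Set.Ioc s t, ∑ x, A x * divergence (J r) x ∂(timeVol a b) := by
  have hdiv : ∀ x, Integrable (fun r => divergence (J r) x) (timeVol a b) := by
    intro x
    refine hJ.mono' ?_ (Eventually.of_forall fun r => ?_)
    · simp only [divergence_eq_sum]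
      exact (Finset.measurable_fun_sum _ fun y _ =>
        measurable_fluxFn h.measurable_flux x y).aestronglyMeasurable
    · rw [divergence_eq_sum]
      exact (Finset.abs_sum_le_sum_abs _ _).trans (Finset.single_le_sum
        (f := fun x => ∑ y, |fluxFn (J r) x y|)
        (fun x _ => Finset.sum_nonneg fun y _ => abs_nonneg _) (Finset.mem_univ x))
  rw [integral_finsetSum _ fun x _ => ((hdiv x).const_mul (A x)).integrableOn,
    ← Finset.sum_sub_distrib, ← Finset.sum_neg_distrib]
  refine Finset.sum_congr rfl fun x _ => ?_
  have hc : Continuous fun t => (m t x : ℝ) :=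
    NNReal.continuous_coe.comp ((continuous_apply x).comp h.continuous_mass)
  rw [integral_const_mul, ← sub_mul,
    sub_eq_integral_of_weak_derivative hc (hdiv x) (h.equation x) hst]
  ring

lemma DiscreteCE.sum_eq {m : Time a b → TVertex d V N → ℝ≥0}
    {J : Time a b → AntisymField (G.TAdj N)} (h : DiscreteCE G a b N m J)
    (hJ : Integrable (fun t => absFlux (J t)) (timeVol a b)) (s t : Time a b) :
    ∑ x, m s x = ∑ x, m t x := by
  have key : ∀ s t : Time a b, s ≤ t → ∑ x, m s x = ∑ x, m t x := by
    intro s t hst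
    have := h.sum_sub_eq hJ (fun _ => 1) hst
    simp only [mul_one, one_mul, sum_divergence_eq_zero (tadj_symm G N), integral_zero,
      neg_zero] at this
    rw [← NNReal.coe_inj]
    push_cast
    linarith
  rcases le_total s t with hst | hst
  · exact key s t hst
  · exact (key t s hst).symm

lemma DiscreteCE.krDist_embed_le {m : Time a b → TVertex d V N → ℝ≥0}
    {J : Time a b → AntisymField (G.TAdj N)} (h : DiscreteCE G a b N m J)
    (hJ : Integrable (fun t => absFlux (J t)) (timeVol a b)) {L : ℝ} (hL0 : 0 ≤ L)
    (hL : ∀ x y, G.Adj x y → ∀ i, |(x.1 i : ℝ) - y.1 i| ≤ L) {s t : Time a b} (hst : s ≤ t) :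
    ENNReal.ofReal (krDist (embed N (m t)) (embed N (m s))) ≤
      ∫⁻ r in Set.Icc s t, ENNReal.ofReal (Real.sqrt d * (L + 2) * (mesh N * absFlux (J r)))
        ∂(timeVol a b) := by
  have hm : (0 : ℝ) < mesh N := mesh_pos
  set f : Time a b → ℝ := fun r => Real.sqrt d * (L + 2) * (mesh N * absFlux (J r))
  have hf : Integrable f (timeVol a b) := (hJ.const_mul _).const_mul _
  have hf0 : ∀ r, 0 ≤ f r := fun r => by
    have := absFlux_nonneg (J r)
    positivity
  have h1 : krDist (embed N (m t)) (embed N (m s)) ≤ ∫ r in Set.Ioc s t, f r ∂(timeVol a b) := by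
    refine krDist_le_iff.2 fun ψ hψ => ?_
    rw [integral_embed, integral_embed, h.sum_sub_eq hJ _ hst]
    refine (neg_le_abs _).trans ?_
    rw [← Real.norm_eq_abs]
    refine norm_integral_le_of_norm_le hf.integrableOn (Eventually.of_forall fun r => ?_)
    have h2 := abs_sum_mul_divergence_le (tadj_symm G N) (J r) (fun x => cellAvg ψ x.1)
      (abs_cellAvg_sub_cellAvg_le G hL0 hL hψ)
    refine h2.trans ?_
    have h3 := hf0 r
    simp only [f] at h3 ⊢
    linarith
  refine (ENNReal.ofReal_le_ofReal h1).trans ?_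
  rw [ofReal_integral_eq_lintegral_ofReal hf.integrableOn (Eventually.of_forall hf0)]
  exact lintegral_mono_set Set.Ioc_subset_Icc_self

end Action

end DynOT

/-! ### The compactness theorem -/

theorem mainTheorem3 {d : ℕ} {V : Type*} [Fintype V] (G : PeriodicGraph d V)
    (R₁ : ℝ) (F : Cost G) (hF : IsAdmissible G R₁ F) (hsuper : IsSuperlinear G R₁ F)
    (a b : ℝ) (hab : a < b)
    (N : ℕ → ℕ) [∀ n, NeZero (N n)] (hN : Tendsto N atTop atTop)
    (hNR : ∀ n, (mesh (N n) : ℝ) * G.maxEdgeLength < 1 / 2)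
    (m : ∀ n, Time a b → TVertex d V (N n) → ℝ≥0)
    (haction : (⨆ n, action G F a b (N n) (m n)) < ⊤)
    (hmass : (⨆ n, totalMass (m n)) < ⊤) :
    ∃ (μ : Time a b → FiniteMeasure (Torus d)) (k : ℕ → ℕ),
      MemW11KR μ ∧ KRAbsCont μ ∧ StrictMono k ∧
      TendstoWeakly (fun j => spaceTime fun t => embed (N (k j)) (m (k j) t)) (spaceTime μ) ∧
      (∀ δ : ℝ, 0 < δ → ∃ j₀, ∀ j, j₀ ≤ j → ∀ t,
        krDist (embed (N (k j)) (m (k j) t)) (μ t) < δ) ∧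
      (∀ s t, (μ s).mass = (μ t).mass) := by
  obtain ⟨A₀, hA₀, -⟩ := EReal.lt_iff_exists_real_btwn.1 haction
  have hJ : ∀ n, ∃ J, DiscreteCE G a b (N n) (m n) J ∧
      eintegral (timeVol a b) (fun t => energy G F (N n) (m n t) (J t)) < A₀ := by
    intro n
    have := (le_iSup (fun n => action G F a b (N n) (m n)) n).trans_lt hA₀
    simpa only [action, iInf_lt_iff, exists_prop] using this
  choose J hCE hJA using hJ
  obtain ⟨B₀, hB₀⟩ := ENNReal.lt_iff_exists_nnreal_btwn.1 hmass
  have htot : ∀ n, totalMass (m n) ≤ B₀ := fun n => (le_iSup _ n).trans hB₀.1.le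
  set k := Nat.card {x : Vertex d V // ‖x.1‖ ≤ max G.maxEdgeLength R₁}
  choose C hC0 hC using exists_affine_bound hsuper
  have hE : ∀ (K : ℝ≥0) n t, ((K * (mesh (N n) * absFlux (J n t)) -
      C K * (1 + k * ∑ x, (m n t x : ℝ)) : ℝ) : EReal) ≤ energy G F (N n) (m n t) (J n t) :=
    fun K n t => le_energy_of_le (hC0 K) (hC K) (m n t) (J n t)
  -- Slope `0` bounds the energy below by the mass alone, which controls its negative part. Hence
  -- `A` depends on neither `n` nor the slope used later.
  obtain ⟨A, hA⟩ : ∃ A : ℝ≥0, ∀ n,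
      ∫⁻ t, (energy G F (N n) (m n t) (J n t)).toENNReal ∂(timeVol a b) ≤ A := by
    let q : ℝ≥0∞ := ENNReal.ofReal (C 0) * (ENNReal.ofReal (b - a) + k * B₀)
    have hq : q ≠ ⊤ := by finiteness
    have hA : ENNReal.ofReal A₀ + q ≠ ⊤ := by finiteness
    refine ⟨(ENNReal.ofReal A₀ + q).toNNReal, fun n => ?_⟩
    rw [ENNReal.coe_toNNReal hA]
    refine lintegral_positive_part_le hq (hJA n) ?_
    refine (lintegral_negative_part_le (m := m n) (hC0 0) (k := k) fun t => ?_).trans ?_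
    · simpa using hE 0 n t
    · exact mul_le_mul_right (add_le_add_right (mul_le_mul_right (htot n) _) _) _
  have hflux : ∀ (K : ℝ≥0) n (S : Set (Time a b)),
      ∫⁻ t in S, ENNReal.ofReal (K * (mesh (N n) * absFlux (J n t))) ∂(timeVol a b) ≤
        A + ENNReal.ofReal (C K) *
          ∫⁻ t in S, (1 + k * ∑ x, (m n t x : ℝ≥0∞)) ∂(timeVol a b) :=
    fun K n S => (setLIntegral_flux_le (hC0 K) (hCE n).continuous_mass (hE K n) S).trans
      (add_le_add_left (hA n) _)
  -- Slope `1` suffices here: only finiteness for each `n` is needed, as input to conservation of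
  -- mass.
  have hint : ∀ n, Integrable (fun t => absFlux (J n t)) (timeVol a b) := by
    intro n
    refine integrable_absFlux (hCE n).measurable_flux ?_
    have h1 := hflux 1 n Set.univ
    simp only [NNReal.coe_one, one_mul, Measure.restrict_univ] at h1
    refine h1.trans_lt ?_
    rw [lintegral_add_left measurable_const, lintegral_const_mul' _ _ (ENNReal.natCast_ne_top _),
      lintegral_const, timeVol_univ, one_mul]
    have h2 : ∫⁻ t, ∑ x, (m n t x : ℝ≥0∞) ∂(timeVol a b) ≠ ⊤ :=
      ne_top_of_le_ne_top ENNReal.coe_ne_top (htot n)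
    finiteness
  have hsum := fun n => (hCE n).sum_eq (hint n)
  -- A mass constant in time equals its time integral divided by `b - a`.
  let B : ℝ≥0 := B₀ / (b - a).toNNReal
  have hba : 0 < (b - a).toNNReal := Real.toNNReal_pos.2 (sub_pos.2 hab)
  have hB : ∀ n t, ∑ x, m n t x ≤ B := by
    intro n t
    rw [le_div_iff₀ hba, ← ENNReal.coe_le_coe]
    refine le_trans (le_of_eq ?_) (htot n)
    have h1 : ∀ s, ∑ x, (m n s x : ℝ≥0∞) = ((∑ x, m n t x : ℝ≥0) : ℝ≥0∞) := fun s => by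
      rw [← hsum n s t]; push_cast; rfl
    rw [totalMass, lintegral_congr h1, lintegral_const, timeVol_univ]
    push_cast
    rfl
  obtain ⟨L, hL0, hL⟩ := exists_edge_bound G
  let κ : ℝ≥0 := ⟨Real.sqrt d * (L + 2), by positivity⟩
  have hmassB : ∀ n t, (embed (N n) (m n t)).mass ≤ B := fun n t => by
    rw [mass_embed]; exact hB n t
  obtain ⟨μ, l, hl, hAC, hlim, hunif, hconst⟩ := exists_subseq_krAbsCont
    (fun n t => embed (N n) (m n t)) B hmassB (fun n s t => by
      simp only [mass_embed]; exact hsum n s t)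
    (fun n r => ENNReal.ofReal (κ * (mesh (N n) * absFlux (J n r)))) A (fun K => by
      -- The speed carries the factor `κ`, so the flux bound is used with slope `K κ`; the uniform
      -- mass bound turns its last term into a multiple of the measure of `S`.
      refine ⟨(C (K * κ)).toNNReal * (1 + k * B), fun n S hS => ?_⟩
      rw [← lintegral_const_mul' _ _ ENNReal.coe_ne_top]
      have h1 : ∀ r, (K : ℝ≥0∞) * ENNReal.ofReal (κ * (mesh (N n) * absFlux (J n r))) =
          ENNReal.ofReal ((K * κ : ℝ≥0) * (mesh (N n) * absFlux (J n r))) := fun r => by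
        rw [← ENNReal.ofReal_coe_nnreal, ← ENNReal.ofReal_mul (NNReal.coe_nonneg K)]
        push_cast
        rw [mul_assoc]
      simp only [h1]
      refine (hflux (K * κ) n S).trans ?_
      refine add_le_add_right ?_ _
      rw [ENNReal.coe_mul, mul_assoc]
      refine mul_le_mul_right ?_ _
      refine (lintegral_mono (g := fun _ => 1 + (k : ℝ≥0∞) * B) fun t => ?_).trans_eq ?_
      · refine add_le_add_right (mul_le_mul_right ?_ _) _
        rw [← ENNReal.ofNNReal_finsetSum]
        exact ENNReal.coe_le_coe.2 (hB n t)
      · rw [setLIntegral_const]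
        push_cast
        rfl)
    (fun n s t hst => (hCE n).krDist_embed_le (hint n) hL0 hL hst)
  exact ⟨μ, l, memW11KR_of_krAbsCont hab hAC hconst, hAC, hl,
    tendstoWeakly_spaceTime (fun n t => hmassB (l n) t)
      (fun n => continuous_embed.comp (hCE (l n)).continuous_mass) hlim, hunif, hconst⟩
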